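/- Let $n\ge 1$, $d_1,\dots,d_n\ge 1$, $d=\sum_i d_i$, and let $\mathcal X_i\subset\mathbb R^{d_i}$ be closed convex sets, $\mathcal X=\mathcal X_1\times\cdots\times\mathcal X_n$, with $r\mathbb B\subseteq\mathcal X\subseteq R\mathbb B$ for some $r,R>0$, where $\mathbb B$ is the closed unit ball of $\mathbb R^d$. Let $f_i:\mathcal X\to\mathbb R$ be measurable cost functions such that, for constants $\alpha>0$, $\beta\ge 0$ and every $i$: * (b) $f_i(x_i,x_{-i})$ is convex and $C^1$ in $x_i$, and $\nabla_i f_i$ is $\beta$-Lipschitz on $\mathcal X$; * (d) $g(x)=(\nabla_1f_1(x),\dots,\nabla_nf_n(x))$ satisfies $\langle g(x)-g(x'),x-x'\rangle\ge\alpha\|x-x'\|^2$ for all $x,x'\in\mathcal X$; * (e) $F_*:=\max_i\sup_{x\in\mathcal X}|f_i(x)|^2<\infty$. Then the game has a unique Nash equilibrium $x^\star$, i.e. a unique $x^\star\in\mathcal X$ with $f_i(x^\star)\le f_i(y,x^\star_{-i})$ for all $i$ and all $y\in\mathcal X_i$. Derivative-free gradient play with query radius $\delta>0$ and step sizes $\eta_t$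 starts from some $x^0\in(1-\delta)\mathcal X$; in round $t=0,1,2,\dots$ each player $i$ draws $v_i^t$ uniformly from the unit sphere $\mathbb S_i$ of $\mathbb R^{d_i}$ (all draws independent), plays $x_i^t+\delta v_i^t$, and updates $$x_i^{t+1}=\mathrm{proj}_{(1-\delta)\mathcal X_i}\Big(x_i^t-\eta_t\,\tfrac{d_i}{\delta}f_i(x^t+\delta v^t)\,v_i^t\Big).$$ Put $C=(\alpha+\beta\sqrt n)R+\beta n$ and let $\varepsilon>0$. Assume that either * (c) for some $L\ge 0$ and every $i$ the map $\nabla_i f_i$ is differentiable on $\mathcal X$ with Jacobian $L$-Lipschitz in operator norm, and $\varepsilon<C^2\min\{\frac1{L^2n^3},\frac{4r^2}{\alpha^2}\}$ (with $\frac10=+\infty$); or * $n=1$ and $\varepsilon<4r^2\big((1+\frac\beta\alpha)R+\frac\beta\alpha\big)^2$ (assumption (c) is not needed). Set $\delta=\alpha\sqrt{\varepsilon/4}\,/\,C$ and $\eta_t=\frac{2}{\alpha t}$ for $t\ge1$ ($\eta_0$ is arbitrary), and assume that the played actions are always admissible: $y+\delta u\in\mathcal X_i$ for all $i$, $y\in(1-\delta)\mathcal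 X_i$, $u\in\mathbb S_i$ (this holds, for instance, if $\delta\le1$ and $\mathcal X$ contains the unit ball). Then $$\mathbb E\|x^t-x^\star\|^2\le\varepsilon\qquad\text{for all integers } t\ge\frac{\max\{32\alpha^4\varepsilon R^2,\;64\,C^2F_*d^2n\}}{\alpha^4\varepsilon^2}.$$ -/

import Mathlib

open MeasureTheory ProbabilityTheory Set
open scoped Pointwise

noncomputable section

namespace BanditGame

/-- The strategy space `ℝ^m` of a single player, with the Euclidean norm. -/
abbrev Strat (m : ℕ) : Type := EuclideanSpace ℝ (Fin m)

/-- Joint action profiles `x = (x₁, …, xₙ)`, where `xᵢ ∈ ℝ^(dᵢ)`, with the Euclidean norm of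
`ℝ^(d₁ + ⋯ + dₙ)`. -/
abbrev Profile {n : ℕ} (d : Fin n → ℕ) : Type := PiLp 2 (fun i => Strat (d i))

variable {n : ℕ} {d : Fin n → ℕ}

/-- The product set `X₁ × ⋯ × Xₙ`. -/
def jointSet (X : (i : Fin n) → Set (Strat (d i))) : Set (Profile d) :=
  {x | ∀ i, x i ∈ X i}

/-- The profile `(y, x₋ᵢ)`: player `i` plays `y`, every other player `j` plays `x j`. -/
def deviate (x : Profile d) (i : Fin n) (y : Strat (d i)) : Profile d :=
  WithLp.toLp 2 (Function.update (WithLp.ofLp x) i y)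

/-- `x` is a Nash equilibrium of the game with costs `f i` and strategy sets `X i`. -/
def IsNash (X : (i : Fin n) → Set (Strat (d i))) (f : Fin n → Profile d → ℝ)
    (x : Profile d) : Prop :=
  x ∈ jointSet X ∧ ∀ i, ∀ y ∈ X i, f i x ≤ f i (deviate x i y)

/-- The partial gradient `∇ᵢ h (x)` of `h` with respect to the `i`-th block of variables. It is
taken within `X i`, so it only sees the values of `h` on the strategy sets; when `X i` is convex
with nonempty interior there is at most one such gradient. -/
def partialGrad (X : (i : Fin n) → Set (Strat (d i))) (h : Profile d → ℝ) (i : Fin n)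
    (x : Profile d) : Strat (d i) :=
  gradientWithin (fun y => h (deviate x i y)) (X i) (x i)

/-- The map of individual partial gradients `g(x) = (∇₁f₁(x), …, ∇ₙfₙ(x))`. -/
def gameGrad (X : (i : Fin n) → Set (Strat (d i))) (f : Fin n → Profile d → ℝ)
    (x : Profile d) : Profile d :=
  WithLp.toLp 2 (fun i => partialGrad X (f i) i x)

/-- The set of all values `|fᵢ(x)|²`, over players `i` and profiles `x ∈ X₁ × ⋯ × Xₙ`. -/
def sqCosts (X : (i : Fin n) → Set (Strat (d i))) (f : Fin n → Profile d → ℝ) : Set ℝ :=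
  {c | ∃ i, ∃ x ∈ jointSet X, c = |f i x| ^ 2}

/-- `F_* = maxᵢ sup_{x ∈ X} |fᵢ(x)|²`. -/
def Fstar (X : (i : Fin n) → Set (Strat (d i))) (f : Fin n → Profile d → ℝ) : ℝ :=
  sSup (sqCosts X f)

/-- The standing assumptions on the game, except for the Lipschitz condition on the Jacobian
(see `JacobianLipschitz`). -/
structure StandingAssumption (X : (i : Fin n) → Set (Strat (d i)))
    (f : Fin n → Profile d → ℝ) (α β r R : ℝ) : Prop where
  isClosed : ∀ i, IsClosed (X i)
  convex : ∀ i, Convex ℝ (X i)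
  r_pos : 0 < r
  R_pos : 0 < R
  ball_subset : Metric.closedBall (0 : Profile d) r ⊆ jointSet X
  subset_ball : jointSet X ⊆ Metric.closedBall (0 : Profile d) R
  convexOn : ∀ i, ∀ x ∈ jointSet X, ConvexOn ℝ (X i) (fun y => f i (deviate x i y))
  contDiffOn : ∀ i, ∀ x ∈ jointSet X, ContDiffOn ℝ 1 (fun y => f i (deviate x i y)) (X i)
  β_nonneg : 0 ≤ β
  grad_lipschitz : ∀ i, ∀ x ∈ jointSet X, ∀ x' ∈ jointSet X,
    ‖partialGrad X (f i) i x - partialGrad X (f i) i x'‖ ≤ β * ‖x - x'‖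
  α_pos : 0 < α
  strongly_monotone : ∀ x ∈ jointSet X, ∀ x' ∈ jointSet X,
    α * ‖x - x'‖ ^ 2 ≤ inner ℝ (gameGrad X f x - gameGrad X f x') (x - x')
  bounded : BddAbove (sqCosts X f)

/-- For every player `i`, the map `x ↦ ∇ᵢfᵢ(x)` is differentiable on `X₁ × ⋯ × Xₙ` and its
Jacobian is `L`-Lipschitz there in operator norm. -/
def JacobianLipschitz (X : (i : Fin n) → Set (Strat (d i))) (f : Fin n → Profile d → ℝ)
    (L : ℝ) : Prop :=
  0 ≤ L ∧ ∀ i,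
    DifferentiableOn ℝ (partialGrad X (f i) i) (jointSet X) ∧
    ∀ x ∈ jointSet X, ∀ x' ∈ jointSet X,
      ‖fderivWithin ℝ (partialGrad X (f i) i) (jointSet X) x -
        fderivWithin ℝ (partialGrad X (f i) i) (jointSet X) x'‖ ≤ L * ‖x - x'‖

/-- The unit sphere of `ℝ^m`. -/
abbrev USphere (m : ℕ) : Type := Metric.sphere (0 : Strat m) 1

/-- The uniform distribution on the unit sphere of `ℝ^m`: normalized surface measure. -/
def uniformSphere (m : ℕ) : Measure (USphere m) :=
  ((volume : Measure (Strat m)).toSphere univ)⁻¹ • (volume : Measure (Strat m)).toSphere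

open Classical in
/-- A nearest point of `K` to `z`; for closed convex nonempty `K` it exists and is unique, so this
is the orthogonal projection. (The value is `z` when there is no nearest point.) -/
def proj {m : ℕ} (K : Set (Strat m)) (z : Strat m) : Strat m :=
  if h : ∃ p ∈ K, ∀ q ∈ K, ‖z - p‖ ≤ ‖z - q‖ then h.choose else z

/-- The profile `(xᵢ + δ vᵢ)ᵢ` that is actually played. -/
def played (δ : ℝ) (x : Profile d) (v : (i : Fin n) → USphere (d i)) : Profile d :=
  WithLp.toLp 2 (fun i => x i + δ • (v i : Strat (d i)))

/-- The one-point gradient estimate `(dᵢ / δ) fᵢ(x + δ v) vᵢ` of player `i`. -/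
def gradEst (f : Fin n → Profile d → ℝ) (δ : ℝ) (x : Profile d)
    (v : (i : Fin n) → USphere (d i)) (i : Fin n) : Strat (d i) :=
  ((d i : ℝ) / δ * f i (played δ x v)) • (v i : Strat (d i))

/-- The iterates `x⁰, x¹, x², …` of derivative-free gradient play with query radius `δ`, step
sizes `η t`, initial profile `x0` and sampled directions `v t i`. -/
def iterate (X : (i : Fin n) → Set (Strat (d i))) (f : Fin n → Profile d → ℝ) (δ : ℝ)
    (η : ℕ → ℝ) (x0 : Profile d) (v : ℕ → (i : Fin n) → USphere (d i)) : ℕ → Profile d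
  | 0 => x0
  | t + 1 => WithLp.toLp 2 (fun i =>
      proj ((1 - δ) • X i)
        (iterate X f δ η x0 v t i - η t • gradEst f δ (iterate X f δ η x0 v t) (v t) i))

/-- The constant `(α + β√n) R + β n`. -/
def gameConst (n : ℕ) (α β R : ℝ) : ℝ := (α + β * √(n : ℝ)) * R + β * n

end BanditGame

end

/-! Existence and uniqueness of the equilibrium come from the variational inequality: by
`isNash_iff`, Nash equilibria are the points x⋆ with ⟨g(x⋆), y - x⋆⟩ ≥ 0 for all feasible y. For a
strongly monotone Lipschitz g such a point is the fixed point of a contraction, a short projected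
gradient step (`exists_variational_inequality`).

Convergence is a stochastic approximation argument aimed at z = (1-δ)x⋆, which lies in the set on
which the iterates live. No smoothed game is introduced; the estimator is compared with g itself.
Freeze the directions of the other players: the average of (dᵢ/δ) h(δu) u over the sphere is then as
close to ∇ᵢfᵢ(x) as the gradients of h on the δ-ball are. This is the divergence theorem in
inequality form (`RotationInvariant.norm_smul_integral_sub_le`), obtained from rotation invariance
of the sphere measure and a monotonicity argument in the radius. All points involved are within √n δ
of x, so each player has bias at most β√n δ, and the joint bias is at most δβn
(`norm_meanGrad_sub_le`).

Since x ∈ (1-δ)X is (1-δ)y with y feasible, the variational inequality at x⋆ scales to ⟨g(x⋆), x -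
z⟩ ≥ 0. Replacing g(x⋆) by g(z) costs a further β√n δR. Put c = δ(βn + β√n R). Strong monotonicity
and Young's inequality bound the drift towards z below by (α/2)‖x-z‖² - c²/(2α)
(`drift_le_inner_meanGrad`). Independence of round t from the past and nonexpansiveness of the
projection turn this into a scalar recursion with solution E‖xᵗ-z‖² ≤ K/t + (c/α)²
(`le_div_add_of_recursion`).

The constant C is such that c/α + δR = √(ε/4) =: q. The bound on t gives K/t ≤ q². In L², the
distance to z is thus at most q + c/α, and ‖z - x⋆‖ ≤ δR, so the total is at most 2q = √ε. -/

noncomputable section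
namespace BanditGame

/-! ### Rotation invariance and integration by parts on the sphere -/

section Sphere

variable {E : Type*} [NormedAddCommGroup E] [InnerProductSpace ℝ E]
  [MeasurableSpace E] [BorelSpace E]

/-- The action of a linear isometry on the unit sphere. -/
def sphereMap (φ : E ≃ₗᵢ[ℝ] E) : Metric.sphere (0 : E) 1 ≃ᵐ Metric.sphere (0 : E) 1 where
  toEquiv := φ.toEquiv.subtypeEquiv (by
    intro a
    simp only [mem_sphere_zero_iff_norm]
    exact (φ.norm_map a).symm ▸ Iff.rfl)
  measurable_toFun := by
    refine Measurable.subtype_mk ?_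
    exact φ.continuous.measurable.comp measurable_subtype_coe
  measurable_invFun := by
    refine Measurable.subtype_mk ?_
    exact φ.symm.continuous.measurable.comp measurable_subtype_coe

@[simp]
theorem coe_sphereMap (φ : E ≃ₗᵢ[ℝ] E) (u : Metric.sphere (0 : E) 1) :
    (sphereMap φ u : E) = φ u := rfl

/-- The surface measure of s is, up to a dimensional factor, the volume of the cone (0,1)·s. Forming
cones commutes with linear isometries, and these preserve volume. -/
theorem map_sphereMap_toSphere [FiniteDimensional ℝ E] (φ : E ≃ₗᵢ[ℝ] E) :
    ((volume : Measure E).toSphere).map (sphereMap φ) = (volume : Measure E).toSphere := by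
  ext s hs
  rw [(sphereMap φ).map_apply, Measure.toSphere_apply' _ hs,
    Measure.toSphere_apply' _ ((sphereMap φ).measurable hs)]
  congr 1
  have h : Ioo (0 : ℝ) 1 • ((↑) '' (sphereMap φ ⁻¹' s) : Set E) =
      φ ⁻¹' (Ioo (0 : ℝ) 1 • ((↑) '' s : Set E)) := by
    ext x
    simp only [Set.mem_smul, mem_image, mem_preimage]
    constructor
    · rintro ⟨c, hc, -, ⟨u, hu, rfl⟩, rfl⟩
      exact ⟨c, hc, _, ⟨_, hu, rfl⟩, by simp⟩
    · rintro ⟨c, hc, -, ⟨u, hu, rfl⟩, hx⟩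
      refine ⟨c, hc, _, ⟨(sphereMap φ).symm u, by simpa using hu, rfl⟩, ?_⟩
      have h2 : φ ((sphereMap φ).symm u : E) = u := by
        rw [← coe_sphereMap]; simp
      apply φ.injective
      rw [map_smul, h2, hx]
  rw [h]
  have h3 := φ.measurePreserving.measure_preimage_emb
    φ.toHomeomorph.measurableEmbedding (Ioo (0 : ℝ) 1 • ((↑) '' s : Set E))
  exact h3

/-- A measure on the unit sphere which is invariant under linear isometries. -/
def RotationInvariant (σ : Measure (Metric.sphere (0 : E) 1)) : Prop :=
  ∀ φ : E ≃ₗᵢ[ℝ] E, σ.map (sphereMap φ) = σ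

variable {σ : Measure (Metric.sphere (0 : E) 1)}

theorem RotationInvariant.integral_comp (hσ : RotationInvariant σ) (φ : E ≃ₗᵢ[ℝ] E) (F : E → ℝ) :
    ∫ u, F (φ (u : E)) ∂σ = ∫ u, F (u : E) ∂σ := by
  conv_rhs => rw [← hσ φ, integral_map_equiv]
  rfl

theorem RotationInvariant.integral_inner_eq_zero (hσ : RotationInvariant σ) (e : E) :
    ∫ u, inner ℝ (u : E) e ∂σ = 0 := by
  have h := hσ.integral_comp (LinearIsometryEquiv.neg ℝ) (fun u => inner ℝ u e)
  simp only [LinearIsometryEquiv.coe_neg, inner_neg_left, integral_neg] at h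
  linarith

variable [FiniteDimensional ℝ E] [IsFiniteMeasure σ]

/-- The derivative of a function along a linear rotation field has zero mean over the sphere. -/
theorem RotationInvariant.integral_fderiv_skew_eq_zero (hσ : RotationInvariant σ) (K : E →L[ℝ] E)
    (hK : K ∈ skewAdjoint (E →L[ℝ] E)) (F : E → ℝ) (F' : E → E →L[ℝ] ℝ)
    (hF : ∀ u ∈ Metric.sphere (0 : E) 1, HasFDerivAt F (F' u) u)
    (hF' : ContinuousOn F' (Metric.sphere (0 : E) 1)) :
    ∫ u, F' (u : E) (K u) ∂σ = 0 := by
  let : NormedAlgebra ℚ (E →L[ℝ] E) := NormedAlgebra.restrictScalars ℚ ℝ _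
  -- Skew-adjointness makes exp(θK) orthogonal, so ∫ F(exp(θK)u) dσ is constant in θ. The integral
  -- to be computed is its derivative at θ = 0.
  have hU : ∀ θ : ℝ, NormedSpace.exp (θ • K) ∈ unitary (E →L[ℝ] E) := fun θ =>
    NormedSpace.exp_mem_unitary_of_mem_skewAdjoint (skewAdjoint.smul_mem θ hK)
  let φ : ℝ → (E ≃ₗᵢ[ℝ] E) := fun θ => Unitary.linearIsometryEquiv ⟨_, hU θ⟩
  have hφ : ∀ θ x, φ θ x = NormedSpace.exp (θ • K) x := fun θ x => rfl
  have hφd : ∀ (x : E) θ, HasDerivAt (fun θ => φ θ x) (K (φ θ x)) θ := by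
    intro x θ
    have h1 := (hasDerivAt_exp_smul_const' K θ).clm_apply (hasDerivAt_const θ x)
    simp only [map_zero, add_zero, mul_apply_eq_comp] at h1
    exact h1
  have hφs : ∀ θ (u : Metric.sphere (0 : E) 1), φ θ u ∈ Metric.sphere (0 : E) 1 := by
    intro θ u
    simp
  obtain ⟨C, hC⟩ := (isCompact_sphere (0 : E) 1).exists_bound_of_continuousOn hF'
  have hFc : ContinuousOn F (Metric.sphere (0 : E) 1) :=
    fun u hu => (hF u hu).continuousAt.continuousWithinAt
  have hcont : ∀ θ, Continuous fun u : Metric.sphere (0 : E) 1 => F (φ θ u) := by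
    intro θ
    have : Continuous fun u : Metric.sphere (0 : E) 1 => φ θ (u : E) :=
      (φ θ).continuous.comp continuous_subtype_val
    exact hFc.comp_continuous this (hφs θ)
  have hcont' : Continuous fun u : Metric.sphere (0 : E) 1 => F' (u : E) (K u) :=
    (hF'.comp_continuous continuous_subtype_val (fun u => u.2)).clm_apply
      (K.continuous.comp continuous_subtype_val)
  have key := hasDerivAt_integral_of_dominated_loc_of_deriv_le (μ := σ) (x₀ := (0 : ℝ))
    (F := fun θ u => F (φ θ (u : E))) (F' := fun θ u => F' (φ θ (u : E)) (K (φ θ (u : E))))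
    (bound := fun _ => C * ‖K‖) Filter.univ_mem
    (Filter.Eventually.of_forall fun θ => (hcont θ).aestronglyMeasurable)
    ((hcont 0).integrable_of_hasCompactSupport (HasCompactSupport.of_compactSpace _))
    (by simpa [hφ] using hcont'.aestronglyMeasurable)
    (Filter.Eventually.of_forall fun u θ _ => by
      have h1 := (F' (φ θ (u : E))).le_opNorm (K (φ θ (u : E)))
      have h2 := K.le_opNorm (φ θ (u : E))
      rw [mem_sphere_zero_iff_norm.1 (hφs θ u), mul_one] at h2
      exact h1.trans (mul_le_mul (hC _ (hφs θ u)) h2 (norm_nonneg _)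
        ((norm_nonneg _).trans (hC _ (hφs θ u)))))
    (integrable_const _)
    (Filter.Eventually.of_forall fun u θ _ =>
      (hF _ (hφs θ u)).comp_hasDerivAt θ (hφd u θ))
  have h1 := key.2
  simp only [hσ.integral_comp] at h1
  have h2 := h1.unique (hasDerivAt_const _ _)
  simpa [hφ] using h2

/-- Integration by parts on the sphere. -/
theorem RotationInvariant.integral_tangential (hσ : RotationInvariant σ) {h : E → ℝ} {G : E → E}
    {s : ℝ} (hh : ∀ u ∈ Metric.sphere (0 : E) 1, HasGradientAt h (G (s • u)) (s • u))
    (hG : ContinuousOn (fun u => G (s • u)) (Metric.sphere (0 : E) 1)) (e : E) :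
    s * ∫ u, (inner ℝ (G (s • (u : E))) e - inner ℝ (G (s • (u : E))) u * inner ℝ (u : E) e) ∂σ =
      ((Module.finrank ℝ E : ℝ) - 1) * ∫ u, h (s • (u : E)) * inner ℝ (u : E) e ∂σ := by
  let b := stdOrthonormalBasis ℝ E
  -- These generate the rotations in the planes spanned by bⱼ and e. On the unit sphere ∑ⱼ ⟨bⱼ,u⟩
  -- Kⱼu = e - ⟨u,e⟩u, the tangential part of e. Summing over j the zero-mean statements for
  -- h(su)⟨bⱼ,u⟩ therefore gives the identity, and ∑ⱼ ⟨bⱼ,Kⱼu⟩ = -(dim E - 1)⟨u,e⟩ supplies the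
  -- curvature term.
  let K : Fin (Module.finrank ℝ E) → E →L[ℝ] E := fun j =>
    (innerSL ℝ (b j)).smulRight e - (innerSL ℝ e).smulRight (b j)
  have hKa : ∀ j x, K j x = inner ℝ (b j) x • e - inner ℝ e x • b j := fun j x => by simp [K]
  have hK : ∀ j, K j ∈ skewAdjoint (E →L[ℝ] E) := by
    intro j
    rw [skewAdjoint.mem_iff, ContinuousLinearMap.star_eq_adjoint]
    refine ((ContinuousLinearMap.eq_adjoint_iff _ _).2 fun x y => ?_).symm
    simp only [neg_apply, hKa, inner_neg_left, inner_sub_left, inner_sub_right,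
      real_inner_smul_left, real_inner_smul_right]
    rw [real_inner_comm x e, real_inner_comm x (b j)]
    ring
  let F' : Fin (Module.finrank ℝ E) → E → E →L[ℝ] ℝ := fun j u =>
    h (s • u) • innerSL ℝ (b j) + inner ℝ (b j) u • (s • innerSL ℝ (G (s • u)))
  have hF : ∀ j, ∀ u ∈ Metric.sphere (0 : E) 1,
      HasFDerivAt (fun u => h (s • u) * inner ℝ (b j) u) (F' j u) u := by
    intro j u hu
    have h1 : HasFDerivAt (fun u => h (s • u)) (s • innerSL ℝ (G (s • u))) u := by
      have := (hh u hu).hasFDerivAt.comp u ((hasFDerivAt_id u).const_smul s)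
      refine this.congr_fderiv ?_
      ext w
      simp
    exact h1.mul (innerSL ℝ (b j)).hasFDerivAt
  have hhc : ContinuousOn (fun u => h (s • u)) (Metric.sphere (0 : E) 1) := by
    intro u hu
    have h1 : ContinuousAt h (s • u) := (hh u hu).hasFDerivAt.continuousAt
    exact (ContinuousAt.comp (f := fun u : E => s • u) h1
      (continuous_const_smul s).continuousAt).continuousWithinAt
  have hF' : ∀ j, ContinuousOn (F' j) (Metric.sphere (0 : E) 1) := by
    intro j
    have h1 : ContinuousOn (fun u => innerSL ℝ (G (s • u))) (Metric.sphere (0 : E) 1) :=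
      (innerSL ℝ).continuous.comp_continuousOn hG
    have h2 : ContinuousOn (fun u => inner ℝ (b j) u) (Metric.sphere (0 : E) 1) :=
      (innerSL ℝ (b j)).continuous.continuousOn
    exact (hhc.smul continuousOn_const).add (h2.smul (h1.const_smul s))
  have hz : ∀ j, ∫ u, F' j (u : E) (K j u) ∂σ = 0 := fun j =>
    hσ.integral_fderiv_skew_eq_zero (K j) (hK j) _ _ (hF j) (hF' j)
  have hGc : Continuous fun u : Metric.sphere (0 : E) 1 => G (s • (u : E)) :=
    hG.comp_continuous continuous_subtype_val (fun u => u.2)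
  have hhc' : Continuous fun u : Metric.sphere (0 : E) 1 => h (s • (u : E)) :=
    hhc.comp_continuous continuous_subtype_val (fun u => u.2)
  have hint : ∀ j, Integrable (fun u : Metric.sphere (0 : E) 1 => F' j (u : E) (K j u)) σ := by
    intro j
    refine Continuous.integrable_of_hasCompactSupport ?_ (HasCompactSupport.of_compactSpace _)
    exact ((hF' j).comp_continuous continuous_subtype_val (fun u => u.2)).clm_apply
      ((K j).continuous.comp continuous_subtype_val)
  have hsum : ∫ u, ∑ j, F' j (u : E) (K j u) ∂σ = 0 := by
    rw [integral_finsetSum _ (fun j _ => hint j)]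
    exact Finset.sum_eq_zero fun j _ => hz j
  have hpt : ∀ u : Metric.sphere (0 : E) 1, ∑ j, F' j (u : E) (K j u) =
      s * (inner ℝ (G (s • (u : E))) e - inner ℝ (G (s • (u : E))) u * inner ℝ (u : E) e) -
      ((Module.finrank ℝ E : ℝ) - 1) * (h (s • (u : E)) * inner ℝ (u : E) e) := by
    intro u
    have e1 : ∑ j, inner ℝ (u : E) (b j) * inner ℝ (b j) (u : E) = 1 := by
      rw [b.sum_inner_mul_inner, real_inner_self_eq_norm_sq, mem_sphere_zero_iff_norm.1 u.2]
      norm_num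
    have e2 := b.sum_inner_mul_inner (G (s • (u : E))) (u : E)
    have e3 := b.sum_inner_mul_inner (u : E) e
    have e4 : ∀ j, inner ℝ (b j) (b j) = (1 : ℝ) := fun j => by
      rw [real_inner_self_eq_norm_sq, b.norm_eq_one]; norm_num
    have e5 : ∀ j, F' j (u : E) (K j u) =
        h (s • (u : E)) * (inner ℝ (u : E) (b j) * inner ℝ (b j) e) -
        h (s • (u : E)) * inner ℝ (u : E) e +
        s * inner ℝ (G (s • (u : E))) e * (inner ℝ (u : E) (b j) * inner ℝ (b j) (u : E)) -
        s * inner ℝ (u : E) e * (inner ℝ (G (s • (u : E))) (b j) * inner ℝ (b j) (u : E)) := by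
      intro j
      simp only [F', hKa, add_apply, smul_apply,
        innerSL_apply_apply, inner_sub_right, real_inner_smul_right, e4, smul_eq_mul]
      rw [real_inner_comm (u : E) e, real_inner_comm (u : E) (b j)]
      ring
    simp only [e5, Finset.sum_add_distrib, Finset.sum_sub_distrib, ← Finset.mul_sum, e1, e2, e3,
      Finset.sum_const, Finset.card_univ, Fintype.card_fin, nsmul_eq_mul]
    ring
  simp only [hpt] at hsum
  rw [integral_sub, integral_const_mul, integral_const_mul] at hsum
  · linarith
  · refine Continuous.integrable_of_hasCompactSupport ?_ (HasCompactSupport.of_compactSpace _)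
    exact continuous_const.mul ((hGc.inner continuous_const).sub
      ((hGc.inner continuous_subtype_val).mul (continuous_subtype_val.inner continuous_const)))
  · refine Continuous.integrable_of_hasCompactSupport ?_ (HasCompactSupport.of_compactSpace _)
    exact continuous_const.mul (hhc'.mul (continuous_subtype_val.inner continuous_const))

end Sphere

/-! ### From spherical means to gradients on the ball -/

section SphereMean

variable {E : Type*} [NormedAddCommGroup E] [InnerProductSpace ℝ E]

theorem smul_sphere_mem_ball {s δ : ℝ} (hs : s ∈ Ioo 0 δ) (u : Metric.sphere (0 : E) 1) :
    s • (u : E) ∈ Metric.ball (0 : E) δ := by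
  rw [mem_ball_zero_iff, norm_smul, mem_sphere_zero_iff_norm.1 u.2, mul_one, Real.norm_eq_abs,
    abs_of_pos hs.1]
  exact hs.2

theorem smul_sphere_mem_closedBall {s δ : ℝ} (hs : s ∈ Icc 0 δ) (u : Metric.sphere (0 : E) 1) :
    s • (u : E) ∈ Metric.closedBall (0 : E) δ := by
  rw [mem_closedBall_zero_iff, norm_smul, mem_sphere_zero_iff_norm.1 u.2, mul_one,
    Real.norm_eq_abs, abs_of_nonneg hs.1]
  exact hs.2

variable [FiniteDimensional ℝ E] [MeasurableSpace E] [BorelSpace E]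
  {σ : Measure (Metric.sphere (0 : E) 1)}

/-- The weighted spherical mean `s ^ (m - 1) ∫ h (s u) ⟪u, e⟫` is an antiderivative of
`s ^ (m - 1) ∫ ⟪G (s u), e⟫`, where `G` is the gradient of `h` and `m` is the dimension. -/
theorem RotationInvariant.hasDerivAt_pow_mul_integral [IsFiniteMeasure σ]
    (hσ : RotationInvariant σ) {h : E → ℝ} {G : E → E} {δ C : ℝ}
    (hh : ∀ y ∈ Metric.ball (0 : E) δ, HasGradientAt h (G y) y)
    (hG : ContinuousOn G (Metric.ball (0 : E) δ))
    (hC : ∀ y ∈ Metric.ball (0 : E) δ, ‖G y‖ ≤ C) (e : E)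
    {m : ℕ} (hm : Module.finrank ℝ E = m + 1) {s : ℝ} (hs : s ∈ Ioo 0 δ) :
    HasDerivAt (fun s : ℝ => s ^ m * ∫ u, h (s • (u : E)) * inner ℝ (u : E) e ∂σ)
      (s ^ m * ∫ u, inner ℝ (G (s • (u : E))) e ∂σ) s := by
  have hGc : ∀ s ∈ Ioo 0 δ, Continuous fun u : Metric.sphere (0 : E) 1 => G (s • (u : E)) :=
    fun s hs => hG.comp_continuous (continuous_subtype_val.const_smul s)
      (fun u => smul_sphere_mem_ball hs u)
  have hhc : ∀ s ∈ Ioo 0 δ, Continuous fun u : Metric.sphere (0 : E) 1 => h (s • (u : E)) :=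
    fun s hs => ContinuousOn.comp_continuous (s := Metric.ball (0 : E) δ)
      (fun y hy => (hh y hy).hasFDerivAt.continuousAt.continuousWithinAt)
      (continuous_subtype_val.const_smul s) (fun u => smul_sphere_mem_ball hs u)
  have hin : Continuous fun u : Metric.sphere (0 : E) 1 => inner ℝ (u : E) e :=
    continuous_subtype_val.inner continuous_const
  have hFc : ∀ s ∈ Ioo 0 δ, Continuous fun u : Metric.sphere (0 : E) 1 =>
      h (s • (u : E)) * inner ℝ (u : E) e := fun s hs => (hhc s hs).mul hin
  have hF'c : Continuous fun u : Metric.sphere (0 : E) 1 =>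
      inner ℝ (G (s • (u : E))) (u : E) * inner ℝ (u : E) e :=
    ((hGc s hs).inner continuous_subtype_val).mul hin
  have hnb : Ioo 0 δ ∈ nhds s := Ioo_mem_nhds hs.1 hs.2
  have hd := (hasDerivAt_integral_of_dominated_loc_of_deriv_le (μ := σ) (x₀ := s)
    (F := fun s u => h (s • (u : E)) * inner ℝ (u : E) e)
    (F' := fun s u => inner ℝ (G (s • (u : E))) (u : E) * inner ℝ (u : E) e)
    (bound := fun _ => C * ‖e‖) hnb
    (Filter.eventually_of_mem hnb fun s hs => (hFc s hs).aestronglyMeasurable)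
    ((hFc s hs).integrable_of_hasCompactSupport (HasCompactSupport.of_compactSpace _))
    hF'c.aestronglyMeasurable
    (Filter.Eventually.of_forall fun u s hs => by
      have h1 := abs_real_inner_le_norm (G (s • (u : E))) (u : E)
      have h2 := abs_real_inner_le_norm (u : E) e
      have h3 := hC _ (smul_sphere_mem_ball hs u)
      rw [mem_sphere_zero_iff_norm.1 u.2] at h1 h2
      rw [Real.norm_eq_abs, abs_mul]
      exact mul_le_mul (by linarith) (by linarith) (abs_nonneg _) ((norm_nonneg _).trans h3))
    (integrable_const _)
    (Filter.Eventually.of_forall fun u s hs => by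
      have h1 : HasDerivAt (fun s : ℝ => s • (u : E)) (u : E) s := by
        simpa using (hasDerivAt_id s).smul_const (u : E)
      have h2 := (hh _ (smul_sphere_mem_ball hs u)).hasFDerivAt.comp_hasDerivAt s h1
      exact h2.mul_const _)).2
  have htan := hσ.integral_tangential (h := h) (G := G) (s := s)
    (fun u hu => hh _ (smul_sphere_mem_ball hs ⟨u, hu⟩))
    (continuousOn_iff_continuous_domRestrict.2 (hGc s hs)) e
  rw [integral_sub
    (((hGc s hs).inner continuous_const).integrable_of_hasCompactSupport
      (HasCompactSupport.of_compactSpace _))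
    (hF'c.integrable_of_hasCompactSupport (HasCompactSupport.of_compactSpace _)), hm] at htan
  refine ((hasDerivAt_pow m s).mul hd).congr_deriv ?_
  -- The tangential identity turns the term m sᵐ⁻¹ ∫ h⟨u,e⟩ into what is missing from the radial
  -- derivative. For m = 0 that term vanishes, and dividing the identity by s ≠ 0 suffices.
  rcases m with _ | m
  · have hs0 := hs.1.ne'
    simp only [zero_add, Nat.cast_one, sub_self, zero_mul, mul_eq_zero, hs0, false_or] at htan
    simp only [Nat.cast_zero, pow_zero, zero_mul, one_mul, zero_add]
    linarith
  · push_cast at htan ⊢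
    simp only [pow_succ]
    linear_combination (-s ^ m) * htan

/-- The mean over the sphere of `h (δ u) u`, suitably scaled, is within `B` of `G₀` if the gradient
of `h` on the ball is. -/
theorem RotationInvariant.norm_smul_integral_sub_le [IsProbabilityMeasure σ]
    (hσ : RotationInvariant σ) {h : E → ℝ} {G : E → E} {δ B : ℝ} {G₀ : E} (hδ : 0 < δ)
    (hcont : ContinuousOn h (Metric.closedBall (0 : E) δ))
    (hh : ∀ y ∈ Metric.ball (0 : E) δ, HasGradientAt h (G y) y)
    (hG : ContinuousOn G (Metric.ball (0 : E) δ))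
    (hB : ∀ y ∈ Metric.ball (0 : E) δ, ‖G y - G₀‖ ≤ B) (hE : 0 < Module.finrank ℝ E) :
    ‖((Module.finrank ℝ E : ℝ) / δ) • ∫ u, h (δ • (u : E)) • (u : E) ∂σ - G₀‖ ≤ B := by
  obtain ⟨m, hm⟩ : ∃ m, Module.finrank ℝ E = m + 1 := ⟨_, (Nat.succ_pred_eq_of_pos hE).symm⟩
  have hhc : ∀ s ∈ Icc 0 δ, Continuous fun u : Metric.sphere (0 : E) 1 => h (s • (u : E)) :=
    fun s hs => hcont.comp_continuous (continuous_subtype_val.const_smul s)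
      (fun u => smul_sphere_mem_closedBall hs u)
  have hin : ∀ e, Continuous fun u : Metric.sphere (0 : E) 1 => inner ℝ (u : E) e :=
    fun e => continuous_subtype_val.inner continuous_const
  obtain ⟨D, hD⟩ := (isCompact_closedBall (0 : E) δ).exists_bound_of_continuousOn hcont
  have hB0 : 0 ≤ B := (norm_nonneg _).trans (hB 0 (by simpa using hδ))
  have hGb : ∀ y ∈ Metric.ball (0 : E) δ, ‖G y‖ ≤ B + ‖G₀‖ := fun y hy => by
    have := norm_sub_norm_le (G y) G₀
    linarith [hB y hy]
  have main : ∀ e : E, ((Module.finrank ℝ E : ℝ) / δ) *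
      ∫ u, h (δ • (u : E)) * inner ℝ (u : E) e ∂σ - inner ℝ G₀ e ≤ B * ‖e‖ := by
    intro e
    let W : ℝ → ℝ := fun s => s ^ m * ∫ u, h (s • (u : E)) * inner ℝ (u : E) e ∂σ
    have hMc : ContinuousOn W (Icc 0 δ) := by
      refine (continuousOn_pow m).mul ?_
      refine continuousOn_of_dominated (bound := fun _ => D * ‖e‖)
        (fun s hs => ((hhc s hs).mul (hin e)).aestronglyMeasurable) ?_ (integrable_const _) ?_
      · intro s hs
        refine Filter.Eventually.of_forall fun u => ?_
        have h2 := norm_inner_le_norm (𝕜 := ℝ) (u : E) e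
        have h3 := hD _ (smul_sphere_mem_closedBall hs u)
        rw [mem_sphere_zero_iff_norm.1 u.2] at h2
        rw [norm_mul]
        exact mul_le_mul h3 (by linarith) (norm_nonneg _) ((norm_nonneg _).trans h3)
      · refine Filter.Eventually.of_forall fun u => ?_
        refine ContinuousOn.mul ?_ continuousOn_const
        exact hcont.comp (continuous_id.smul continuous_const).continuousOn
          (fun s hs => smul_sphere_mem_closedBall hs u)
    -- The bound on G gives ⟨G(su), e⟩ ≤ c throughout the ball, hence W' ≤ c sᵐ. Comparing W with c
    -- sᵐ⁺¹/(m+1) on [0, δ] needs derivatives only in the open interval, so h need only be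
    -- continuous up to the boundary of the ball.
    let c : ℝ := inner ℝ G₀ e + B * ‖e‖
    have hWd : ∀ s ∈ Ioo 0 δ, HasDerivAt (fun s => s ^ (m + 1) / ((m : ℝ) + 1) * c - W s)
        (s ^ m * c - s ^ m * ∫ u, inner ℝ (G (s • (u : E))) e ∂σ) s := by
      intro s hs
      refine HasDerivAt.sub ?_ (hσ.hasDerivAt_pow_mul_integral hh hG hGb e hm hs)
      have h1 := ((hasDerivAt_pow (m + 1) s).div_const ((m : ℝ) + 1)).mul_const c
      refine h1.congr_deriv ?_
      have : (m : ℝ) + 1 ≠ 0 := by positivity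
      push_cast
      field_simp
    have hmono : MonotoneOn (fun s => s ^ (m + 1) / ((m : ℝ) + 1) * c - W s) (Icc 0 δ) := by
      refine monotoneOn_of_deriv_nonneg (convex_Icc 0 δ) ?_ ?_ ?_
      · exact ContinuousOn.sub (by fun_prop) hMc
      · rw [interior_Icc]
        exact fun s hs => (hWd s hs).differentiableAt.differentiableWithinAt
      · rw [interior_Icc]
        intro s hs
        rw [(hWd s hs).deriv, ← mul_sub]
        refine mul_nonneg (pow_nonneg hs.1.le _) (sub_nonneg.2 ?_)
        have h1 : ∫ u, inner ℝ (G (s • (u : E))) e ∂σ ≤ ∫ _, c ∂σ := by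
          refine integral_mono ?_ (integrable_const _) fun u => ?_
          · refine Continuous.integrable_of_hasCompactSupport ?_
              (HasCompactSupport.of_compactSpace _)
            exact (hG.comp_continuous (continuous_subtype_val.const_smul s)
              (fun u => smul_sphere_mem_ball hs u)).inner continuous_const
          · have h2 := real_inner_le_norm (G (s • (u : E)) - G₀) e
            rw [inner_sub_left] at h2
            have h3 := mul_le_mul_of_nonneg_right (hB _ (smul_sphere_mem_ball hs u))
              (norm_nonneg e)
            simp only [c]
            linarith
        simpa using h1
    -- For m = 0 the factor sᵐ does not vanish at 0. Antipodal symmetry makes the integral zero in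
    -- every dimension.
    have hW0 : W 0 = 0 := by
      simp only [W, zero_smul, integral_const_mul, hσ.integral_inner_eq_zero, mul_zero]
    have h1 := hmono (left_mem_Icc.2 hδ.le) (right_mem_Icc.2 hδ.le) hδ.le
    simp only [hW0] at h1
    have h2 : W δ ≤ δ ^ (m + 1) / ((m : ℝ) + 1) * c := by
      have : (0 : ℝ) ^ (m + 1) / ((m : ℝ) + 1) * c = 0 := by simp
      linarith
    have h3 : ((Module.finrank ℝ E : ℝ) / δ) * ∫ u, h (δ • (u : E)) * inner ℝ (u : E) e ∂σ ≤ c := by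
      have hpos : 0 < δ ^ (m + 1) / ((m : ℝ) + 1) := by positivity
      refine le_of_mul_le_mul_left ?_ hpos
      refine le_trans (le_of_eq ?_) h2
      rw [hm]
      simp only [W]
      push_cast
      field_simp
      ring
    simp only [c] at h3
    linarith
  -- Testing against the error itself: ‖w‖² ≤ B‖w‖.
  let w : E := ((Module.finrank ℝ E : ℝ) / δ) • ∫ u, h (δ • (u : E)) • (u : E) ∂σ - G₀
  have hw := main w
  have hint : Integrable (fun u : Metric.sphere (0 : E) 1 => h (δ • (u : E)) • (u : E)) σ :=
    ((hhc δ (right_mem_Icc.2 hδ.le)).smul continuous_subtype_val).integrable_of_hasCompactSupport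
      (HasCompactSupport.of_compactSpace _)
  have h1 : ∫ u, h (δ • (u : E)) * inner ℝ (u : E) w ∂σ =
      inner ℝ (∫ u, h (δ • (u : E)) • (u : E) ∂σ) w := by
    rw [real_inner_comm, ← integral_inner hint]
    refine integral_congr_ae (Filter.Eventually.of_forall fun u => ?_)
    simp only [real_inner_smul_right]
    rw [real_inner_comm]
  rw [h1, ← real_inner_smul_left, ← inner_sub_left] at hw
  change inner ℝ w w ≤ B * ‖w‖ at hw
  change ‖w‖ ≤ B
  rw [real_inner_self_eq_norm_sq, sq] at hw
  by_contra hcon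
  push Not at hcon
  have : 0 < ‖w‖ := hB0.trans_lt hcon
  nlinarith

end SphereMean

/-! ### The normalized surface measure -/

section UniformSphere

theorem volume_toSphere_univ_ne_zero {m : ℕ} (hm : 0 < m) :
    (volume : Measure (Strat m)).toSphere univ ≠ 0 := by
  rw [Measure.measure_univ_ne_zero, Ne, Measure.toSphere_eq_zero_iff_finrank]
  simp [hm.ne']

theorem isProbabilityMeasure_uniformSphere {m : ℕ} (hm : 0 < m) :
    IsProbabilityMeasure (uniformSphere m) :=
  ⟨by
    rw [uniformSphere, Measure.smul_apply, smul_eq_mul]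
    exact ENNReal.inv_mul_cancel (volume_toSphere_univ_ne_zero hm) (measure_ne_top _ _)⟩

theorem rotationInvariant_uniformSphere (m : ℕ) : RotationInvariant (uniformSphere m) := by
  intro φ
  rw [uniformSphere, Measure.map_smul, map_sphereMap_toSphere]

end UniformSphere

/-! ### Projections and variational inequalities -/

section Projection

variable {H : Type*} [NormedAddCommGroup H] [InnerProductSpace ℝ H]

theorem exists_inner_sub_nonpos [CompleteSpace H] {K : Set H} (hne : K.Nonempty)
    (hcl : IsClosed K) (hK : Convex ℝ K) (z : H) :
    ∃ p ∈ K, ∀ w ∈ K, inner ℝ (z - p) (w - p) ≤ 0 := by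
  obtain ⟨p, hp, h⟩ := exists_norm_eq_iInf_of_complete_convex hne hcl.isComplete hK z
  exact ⟨p, hp, (norm_eq_iInf_iff_real_inner_le_zero hK hp).1 h⟩

theorem norm_sub_le_of_inner_sub_nonpos {z p w : H} (h : inner ℝ (z - p) (w - p) ≤ 0) :
    ‖z - p‖ ≤ ‖z - w‖ ∧ ‖p - w‖ ≤ ‖z - w‖ := by
  have h1 : ‖z - w‖ ^ 2 = ‖z - p‖ ^ 2 - 2 * inner ℝ (z - p) (w - p) + ‖w - p‖ ^ 2 := by
    rw [← norm_sub_sq_real]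
    congr 2
    abel
  rw [norm_sub_rev p w]
  constructor <;> refine le_of_sq_le_sq ?_ (norm_nonneg _) <;>
    nlinarith [sq_nonneg ‖w - p‖, sq_nonneg ‖z - p‖]

theorem norm_sub_le_of_inner_sub_nonpos_of_inner_sub_nonpos {z z' p p' : H}
    (h : inner ℝ (z - p) (p' - p) ≤ 0) (h' : inner ℝ (z' - p') (p - p') ≤ 0) :
    ‖p - p'‖ ≤ ‖z - z'‖ := by
  have h1 : inner ℝ (p - p') (p - p') ≤ inner ℝ (z - z') (p - p') := by
    have e1 : inner ℝ (z - p) (p' - p) = - inner ℝ (z - p) (p - p') := by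
      rw [← inner_neg_right, neg_sub]
    have e2 : (z - z') = (z - p) - (z' - p') + (p - p') := by abel
    rw [e2, inner_add_left, inner_sub_left (z - p)]
    linarith
  rw [real_inner_self_eq_norm_sq] at h1
  have h2 := real_inner_le_norm (z - z') (p - p')
  by_contra hcon
  push Not at hcon
  have : 0 < ‖p - p'‖ := (norm_nonneg _).trans_lt hcon
  nlinarith

variable {m : ℕ} {K : Set (Strat m)}

/-- `proj` is some chosen minimizer of the distance. In a convex set every minimizer satisfies the
obtuse-angle inequality, which is the only property used later, so the choice does not matter. -/
theorem proj_spec (hne : K.Nonempty) (hcl : IsClosed K) (hK : Convex ℝ K) (z : Strat m) :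
    proj K z ∈ K ∧ ∀ q ∈ K, inner ℝ (z - proj K z) (q - proj K z) ≤ 0 := by
  have h : ∃ p ∈ K, ∀ q ∈ K, ‖z - p‖ ≤ ‖z - q‖ := by
    obtain ⟨p, hp, h⟩ := exists_inner_sub_nonpos hne hcl hK z
    exact ⟨p, hp, fun q hq => (norm_sub_le_of_inner_sub_nonpos (h q hq)).1⟩
  have hc := h.choose_spec
  have e : proj K z = h.choose := by rw [proj, dif_pos h]
  rw [e]
  refine ⟨hc.1, (norm_eq_iInf_iff_real_inner_le_zero hK hc.1).1 ?_⟩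
  have : Nonempty K := hne.to_subtype
  refine le_antisymm (le_ciInf fun w => hc.2 w w.2) ?_
  exact ciInf_le ⟨0, by rintro - ⟨w, rfl⟩; exact norm_nonneg _⟩ (⟨h.choose, hc.1⟩ : K)

theorem norm_proj_sub_le (hne : K.Nonempty) (hcl : IsClosed K) (hK : Convex ℝ K) (z : Strat m)
    {w : Strat m} (hw : w ∈ K) : ‖proj K z - w‖ ≤ ‖z - w‖ :=
  (norm_sub_le_of_inner_sub_nonpos ((proj_spec hne hcl hK z).2 w hw)).2

theorem continuous_proj (hne : K.Nonempty) (hcl : IsClosed K) (hK : Convex ℝ K) :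
    Continuous (proj K) := by
  refine (LipschitzWith.of_dist_le_mul (K := 1) fun z z' => ?_).continuous
  rw [dist_eq_norm, dist_eq_norm, NNReal.coe_one, one_mul]
  have h := proj_spec hne hcl hK z
  have h' := proj_spec hne hcl hK z'
  exact norm_sub_le_of_inner_sub_nonpos_of_inner_sub_nonpos (h.2 _ h'.1) (h'.2 _ h.1)

/-- The variational inequality of a strongly monotone Lipschitz map on a closed convex set has a
solution. -/
theorem exists_variational_inequality [CompleteSpace H] {S : Set H} (hne : S.Nonempty)
    (hcl : IsClosed S) (hS : Convex ℝ S) {g : H → H} {α ℓ : ℝ} (hα : 0 < α)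
    (hmono : ∀ x ∈ S, ∀ y ∈ S, α * ‖x - y‖ ^ 2 ≤ inner ℝ (g x - g y) (x - y))
    (hlip : ∀ x ∈ S, ∀ y ∈ S, ‖g x - g y‖ ≤ ℓ * ‖x - y‖) :
    ∃ x ∈ S, ∀ y ∈ S, 0 ≤ inner ℝ (g x) (y - x) := by
  choose p hpS hp using exists_inner_sub_nonpos hne hcl hS
  -- With this step size 1 - 2sα + s²ℓ² ≤ 1 - sα, so the projected step x ↦ p(x - s g(x)) contracts
  -- by √(1 - sα). The obtuse-angle inequality at its fixed point is the variational inequality.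
  obtain ⟨s, hs, hsα, hsℓ⟩ : ∃ s : ℝ, 0 < s ∧ s * α ≤ 1 ∧ s * ℓ ^ 2 ≤ α := by
    have h0 : 0 < ℓ ^ 2 + α ^ 2 := by positivity
    refine ⟨α / (ℓ ^ 2 + α ^ 2), by positivity, ?_, ?_⟩
    · rw [div_mul_eq_mul_div, div_le_one h0]
      nlinarith [sq_nonneg ℓ]
    · rw [div_mul_eq_mul_div, div_le_iff₀ h0]
      nlinarith [pow_pos hα 3]
  let T : S → S := fun x => ⟨p (x - s • g x), hpS _⟩
  have hκ : 0 ≤ 1 - s * α := by linarith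
  have hT : ContractingWith (Real.toNNReal √(1 - s * α)) T := by
    refine ⟨?_, LipschitzWith.of_dist_le_mul fun x y => ?_⟩
    · rw [Real.toNNReal_lt_one, Real.sqrt_lt' one_pos]
      nlinarith
    · rw [Real.coe_toNNReal _ (Real.sqrt_nonneg _), Subtype.dist_eq, Subtype.dist_eq, dist_eq_norm,
        dist_eq_norm]
      refine (norm_sub_le_of_inner_sub_nonpos_of_inner_sub_nonpos (hp _ _ (hpS _))
        (hp _ _ (hpS _))).trans ?_
      refine le_of_sq_le_sq ?_ (by positivity)
      rw [mul_pow, Real.sq_sqrt hκ]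
      have e : (x : H) - s • g x - (y - s • g y) = (x - y) - s • (g x - g y) := by
        rw [smul_sub]; abel
      rw [e, norm_sub_sq_real, real_inner_smul_right, norm_smul, mul_pow, Real.norm_eq_abs, sq_abs,
        real_inner_comm]
      have h1 := hmono x x.2 y y.2
      have h2 : ‖g x - g y‖ ^ 2 ≤ ℓ ^ 2 * ‖(x : H) - y‖ ^ 2 := by
        rw [← mul_pow]
        exact pow_le_pow_left₀ (norm_nonneg _) (hlip x x.2 y y.2) 2
      have h3 : s ^ 2 * ‖g x - g y‖ ^ 2 ≤ s * α * ‖(x : H) - y‖ ^ 2 := by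
        calc s ^ 2 * ‖g x - g y‖ ^ 2 ≤ s ^ 2 * (ℓ ^ 2 * ‖(x : H) - y‖ ^ 2) := by gcongr
          _ = s * (s * ℓ ^ 2) * ‖(x : H) - y‖ ^ 2 := by ring
          _ ≤ s * α * ‖(x : H) - y‖ ^ 2 := by gcongr
      have h4 := mul_le_mul_of_nonneg_left h1 hs.le
      linarith
  have : Nonempty S := hne.to_subtype
  have : CompleteSpace S := hcl.completeSpace_coe
  let x := ContractingWith.fixedPoint T hT
  have hx : T x = x := hT.fixedPoint_isFixedPt
  refine ⟨x, x.2, fun y hy => ?_⟩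
  have h1 : p (x - s • g x) = x := congrArg Subtype.val hx
  have h2 := hp (x - s • g x) y hy
  rw [h1] at h2
  have h3 : (x : H) - s • g x - x = -(s • g x) := by abel
  rw [h3, inner_neg_left, real_inner_smul_left] at h2
  by_contra hcon
  push Not at hcon
  nlinarith

end Projection

/-! ### First-order conditions on convex sets -/

section FirstOrder

variable {H : Type*} [NormedAddCommGroup H] [InnerProductSpace ℝ H] [CompleteSpace H]

theorem inner_gradientWithin_nonneg_of_isMinOn {S : Set H} (hS : Convex ℝ S) {h : H → ℝ} {x y G : H}
    (hx : x ∈ S) (hy : y ∈ S) (hG : HasGradientWithinAt h G S x) (hmin : ∀ z ∈ S, h x ≤ h z) :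
    0 ≤ inner ℝ G (y - x) := by
  have h1 : IsLocalMinOn h S x := (isMinOn_iff.2 hmin).localize
  have h2 := h1.hasFDerivWithinAt_nonneg hG.hasFDerivWithinAt
    (sub_mem_posTangentConeAt_of_segment_subset (hS.segment_subset hx hy))
  simpa using h2

/-- On the segment from x to y, convexity bounds every difference quotient at x by h(y) - h(x); let
the parameter tend to 0. A one-sided derivative suffices, so x may lie on the boundary of S. -/
theorem _root_.ConvexOn.add_inner_le_of_hasGradientWithinAt {S : Set H} {h : H → ℝ}
    (hh : ConvexOn ℝ S h) {x y G : H} (hx : x ∈ S) (hy : y ∈ S) (hG : HasGradientWithinAt h G S x) :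
    h x + inner ℝ G (y - x) ≤ h y := by
  have hmap : MapsTo (fun t : ℝ => x + t • (y - x)) (Icc 0 1) S := fun t ht =>
    hh.1.add_smul_sub_mem hx hy ht
  have h1 : HasDerivWithinAt (fun t : ℝ => x + t • (y - x)) (y - x) (Icc 0 1) 0 := by
    simpa using (((hasDerivAt_id (0 : ℝ)).smul_const (y - x)).const_add x).hasDerivWithinAt
  have hG' : HasFDerivWithinAt h (InnerProductSpace.toDual ℝ H G) S (x + (0 : ℝ) • (y - x)) := by
    simpa using hG.hasFDerivWithinAt
  have h2 := hG'.comp_hasDerivWithinAt (0 : ℝ) h1 hmap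
  have h3 : HasDerivWithinAt (fun t : ℝ => h (x + t • (y - x))) (inner ℝ G (y - x)) (Ioi 0) 0 :=
    HasDerivWithinAt.mono_of_mem_nhdsWithin (by simpa using! h2)
      (Icc_mem_nhdsGT_of_mem (left_mem_Ico.2 zero_lt_one))
  have h4 : ∀ t ∈ Ioc (0 : ℝ) 1, slope (fun t : ℝ => h (x + t • (y - x))) 0 t ≤ h y - h x := by
    intro t ht
    have h5 := hh.2 hx hy (sub_nonneg.2 ht.2) ht.1.le (by ring)
    have e : (1 - t) • x + t • y = x + t • (y - x) := by
      rw [smul_sub, sub_smul, one_smul]; abel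
    rw [e] at h5
    simp only [smul_eq_mul] at h5
    rw [slope_def_field]
    simp only [zero_smul, add_zero, sub_zero]
    rw [div_le_iff₀ ht.1]
    linarith
  have h5 := le_of_tendsto (hasDerivWithinAt_iff_tendsto_slope' self_notMem_Ioi |>.1 h3)
    (Filter.eventually_of_mem (Ioc_mem_nhdsGT zero_lt_one) h4)
  linarith

end FirstOrder

variable {n : ℕ} {d : Fin n → ℕ}

/-! ### Nash equilibria as solutions of a variational inequality -/

section Game

@[simp]
theorem deviate_same (x : Profile d) (i : Fin n) (y : Strat (d i)) : deviate x i y i = y := by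
  simp [deviate]

theorem deviate_of_ne (x : Profile d) {i j : Fin n} (h : j ≠ i) (y : Strat (d i)) :
    deviate x i y j = x j := by
  simp [deviate, h]

@[simp]
theorem deviate_deviate (x : Profile d) (i : Fin n) (y z : Strat (d i)) :
    deviate (deviate x i y) i z = deviate x i z := by
  simp [deviate]

@[simp]
theorem deviate_self (x : Profile d) (i : Fin n) : deviate x i (x i) = x := by
  simp [deviate]

theorem inner_deviate_sub (g x : Profile d) (i : Fin n) (y : Strat (d i)) :
    inner ℝ g (deviate x i y - x) = inner ℝ (g i) (y - x i) := by
  rw [PiLp.inner_apply, Finset.sum_eq_single i]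
  · simp
  · intro j _ hj
    simp [deviate_of_ne x hj]
  · simp

theorem norm_sq_le_of_forall_norm_le {x : Profile d} {c : ℝ} (h : ∀ i, ‖x i‖ ≤ c) :
    ‖x‖ ^ 2 ≤ n * c ^ 2 := by
  rw [PiLp.norm_sq_eq_of_L2]
  refine (Finset.sum_le_sum fun i _ => pow_le_pow_left₀ (norm_nonneg _) (h i) 2).trans ?_
  simp

theorem norm_le_sqrt_mul_of_forall_norm_le {x : Profile d} {c : ℝ} (hc : 0 ≤ c)
    (h : ∀ i, ‖x i‖ ≤ c) : ‖x‖ ≤ √(n : ℝ) * c := by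
  refine le_of_sq_le_sq ?_ (by positivity)
  rw [mul_pow, Real.sq_sqrt (Nat.cast_nonneg n)]
  exact norm_sq_le_of_forall_norm_le h

variable {X : (i : Fin n) → Set (Strat (d i))} {f : Fin n → Profile d → ℝ} {α β r R : ℝ}

theorem deviate_mem {x : Profile d} (hx : x ∈ jointSet X) {i : Fin n} {y : Strat (d i)}
    (hy : y ∈ X i) : deviate x i y ∈ jointSet X := by
  intro j
  by_cases h : j = i
  · subst h; simpa
  · rw [deviate_of_ne x h]; exact hx j

theorem isClosed_jointSet (h : ∀ i, IsClosed (X i)) : IsClosed (jointSet X) := by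
  have : jointSet X = ⋂ i, (fun x : Profile d => x i) ⁻¹' X i := by
    ext x; simp [jointSet]
  rw [this]
  exact isClosed_iInter fun i => (h i).preimage (PiLp.continuous_apply 2 _ i)

theorem convex_jointSet (h : ∀ i, Convex ℝ (X i)) : Convex ℝ (jointSet X) :=
  fun _ hx _ hy _ _ ha hb hab i => h i (hx i) (hy i) ha hb hab

namespace StandingAssumption

variable (hG : StandingAssumption X f α β r R)
include hG

theorem zero_mem_jointSet : (0 : Profile d) ∈ jointSet X :=
  hG.ball_subset (Metric.mem_closedBall_self hG.r_pos.le)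

theorem zero_mem (i : Fin n) : (0 : Strat (d i)) ∈ X i := hG.zero_mem_jointSet i

theorem norm_le {x : Profile d} (hx : x ∈ jointSet X) : ‖x‖ ≤ R :=
  mem_closedBall_zero_iff.1 (hG.subset_ball hx)

theorem hasGradientWithinAt_deviate {x : Profile d} (hx : x ∈ jointSet X) {i : Fin n}
    {w : Strat (d i)} (hw : w ∈ X i) :
    HasGradientWithinAt (fun y => f i (deviate x i y)) (partialGrad X (f i) i (deviate x i w))
      (X i) w := by
  have h := ((hG.contDiffOn i x hx).differentiableOn one_ne_zero w hw).hasGradientWithinAt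
  simpa [partialGrad] using h

theorem hasGradientWithinAt {x : Profile d} (hx : x ∈ jointSet X) (i : Fin n) :
    HasGradientWithinAt (fun y => f i (deviate x i y)) (partialGrad X (f i) i x) (X i) (x i) := by
  simpa using hG.hasGradientWithinAt_deviate hx (hx i)

theorem norm_gameGrad_sub_le {x y : Profile d} (hx : x ∈ jointSet X) (hy : y ∈ jointSet X) :
    ‖gameGrad X f x - gameGrad X f y‖ ≤ β * √(n : ℝ) * ‖x - y‖ := by
  have hβ := hG.β_nonneg
  have h : ∀ i, ‖(gameGrad X f x - gameGrad X f y) i‖ ≤ β * ‖x - y‖ := fun i =>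
    hG.grad_lipschitz i x hx y hy
  calc ‖gameGrad X f x - gameGrad X f y‖ ≤ √(n : ℝ) * (β * ‖x - y‖) :=
        norm_le_sqrt_mul_of_forall_norm_le (mul_nonneg hβ (norm_nonneg _)) h
    _ = β * √(n : ℝ) * ‖x - y‖ := by ring

/-- Nash equilibria are the solutions of the variational inequality of the game gradient. -/
theorem isNash_iff {x : Profile d} :
    IsNash X f x ↔ x ∈ jointSet X ∧ ∀ y ∈ jointSet X, 0 ≤ inner ℝ (gameGrad X f x) (y - x) := by
  refine and_congr_right fun hx => ⟨fun h y hy => ?_, fun h i y hy => ?_⟩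
  · rw [PiLp.inner_apply]
    refine Finset.sum_nonneg fun i _ => ?_
    refine inner_gradientWithin_nonneg_of_isMinOn (hG.convex i) (hx i) (hy i)
      (hG.hasGradientWithinAt hx i) fun z hz => ?_
    simpa using h i z hz
  -- Conversely, test with a unilateral deviation: only the block of player i survives, and
  -- convexity of the own cost makes the first-order condition sufficient.
  · have h1 := h _ (deviate_mem hx hy)
    rw [inner_deviate_sub] at h1
    have h2 := (hG.convexOn i x hx).add_inner_le_of_hasGradientWithinAt (hx i) hy
      (hG.hasGradientWithinAt hx i)
    simp only [deviate_self] at h2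
    have h3 : gameGrad X f x i = partialGrad X (f i) i x := rfl
    rw [h3] at h1
    linarith

theorem existsUnique_isNash : ∃! x, IsNash X f x := by
  obtain ⟨x, hx, h⟩ := exists_variational_inequality ⟨0, hG.zero_mem_jointSet⟩
    (isClosed_jointSet hG.isClosed) (convex_jointSet hG.convex) hG.α_pos hG.strongly_monotone
    (fun x hx y hy => hG.norm_gameGrad_sub_le hx hy)
  refine ⟨x, hG.isNash_iff.2 ⟨hx, h⟩, fun y hy => ?_⟩
  obtain ⟨hyX, hy⟩ := hG.isNash_iff.1 hy
  -- Adding the variational inequalities at two equilibria gives ⟨g(y) - g(x), y - x⟩ ≤ 0.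
  have h1 := hG.strongly_monotone y hyX x hx
  have h2 := h y hyX
  have h3 := hy x hx
  rw [← neg_sub, inner_neg_right] at h3
  rw [inner_sub_left] at h1
  have h4 : ‖y - x‖ ^ 2 ≤ 0 := by
    by_contra hcon
    push Not at hcon
    nlinarith [mul_pos hG.α_pos hcon]
  rw [← sub_eq_zero, ← norm_eq_zero]
  exact pow_eq_zero_iff two_ne_zero |>.1 (le_antisymm h4 (sq_nonneg _))

theorem sq_abs_le_Fstar {x : Profile d} (hx : x ∈ jointSet X) (i : Fin n) :
    f i x ^ 2 ≤ Fstar X f := by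
  rw [← sq_abs]
  exact le_csSup hG.bounded ⟨i, x, hx, rfl⟩

end StandingAssumption
end Game

/-- Resampling one coordinate of a product probability measure does not change it. -/
theorem map_update_pi_prod {ι : Type*} [Fintype ι] [DecidableEq ι] {Y : ι → Type*}
    [∀ i, MeasurableSpace (Y i)] (μ : (i : ι) → Measure (Y i)) [∀ i, IsProbabilityMeasure (μ i)]
    (i : ι) :
    ((Measure.pi μ).prod (μ i)).map (fun p => Function.update p.1 i p.2) = Measure.pi μ := by
  have hm : Measurable fun p : ((j : ι) → Y j) × Y i => Function.update p.1 i p.2 :=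
    measurable_update'
  refine (Measure.pi_eq fun s hs => ?_).symm
  rw [Measure.map_apply hm (MeasurableSet.univ_pi hs)]
  have e : (fun p : ((j : ι) → Y j) × Y i => Function.update p.1 i p.2) ⁻¹' univ.pi s =
      (univ.pi (Function.update s i univ)) ×ˢ (s i) := by
    ext p
    simp only [mem_preimage, mem_univ_pi, mem_prod]
    constructor
    · refine fun h => ⟨fun j => ?_, by simpa using h i⟩
      by_cases hj : j = i
      · subst hj; simp
      · simpa [hj] using h j
    · rintro ⟨h, hi⟩ j
      by_cases hj : j = i
      · subst hj; simpa using hi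
      · simpa [hj] using h j
  rw [e, Measure.prod_prod, Measure.pi_pi, ← Finset.prod_erase_mul _ _ (Finset.mem_univ i),
    ← Finset.prod_erase_mul Finset.univ (fun j => μ j (s j)) (Finset.mem_univ i)]
  simp only [Function.update_self, measure_univ, mul_one]
  congr 1
  refine Finset.prod_congr rfl fun j hj => ?_
  rw [Function.update_of_ne (Finset.ne_of_mem_erase hj)]

/-! ### Bias and size of the one-point gradient estimate -/

section Estimator

variable {X : (i : Fin n) → Set (Strat (d i))} {f : Fin n → Profile d → ℝ} {α β r R δ : ℝ}

/-- All profiles played from `(1 - δ) X` with query radius `δ` are admissible. -/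
def Admissible (X : (i : Fin n) → Set (Strat (d i))) (δ : ℝ) : Prop :=
  ∀ i, ∀ y ∈ (1 - δ) • X i, ∀ u : USphere (d i), y + δ • (u : Strat (d i)) ∈ X i

/-- The product of the shrunken strategy sets `(1 - δ) Xᵢ`. -/
def shrunkSet (X : (i : Fin n) → Set (Strat (d i))) (δ : ℝ) : Set (Profile d) :=
  jointSet fun i => (1 - δ) • X i

theorem Admissible.played_mem (hA : Admissible X δ) {x : Profile d} (hx : x ∈ shrunkSet X δ)
    (v : (i : Fin n) → USphere (d i)) : played δ x v ∈ jointSet X :=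
  fun i => hA i _ (hx i) (v i)

/-- Admissibility speaks of the δ-sphere only. A point of the ball lies on the chord between two
antipodal points of that sphere, so convexity fills in the ball. -/
theorem Admissible.add_mem (hA : Admissible X δ) (hδ : 0 < δ) {i : Fin n} (hd : 0 < d i)
    (hX : Convex ℝ (X i)) {x y : Strat (d i)} (hx : x ∈ (1 - δ) • X i) (hy : ‖y‖ ≤ δ) :
    x + y ∈ X i := by
  obtain ⟨u, hu⟩ : ∃ u : USphere (d i), y = ‖y‖ • (u : Strat (d i)) := by
    by_cases h : y = 0
    · have : Nontrivial (Strat (d i)) := Module.nontrivial_of_finrank_pos (R := ℝ) (by simpa using hd)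
      obtain ⟨u, hu⟩ := NormedSpace.sphere_nonempty (E := Strat (d i)) (x := 0) (r := 1) |>.2
        zero_le_one
      exact ⟨⟨u, hu⟩, by simp [h]⟩
    · have h0 : ‖y‖ ≠ 0 := norm_ne_zero_iff.2 h
      refine ⟨⟨‖y‖⁻¹ • y, ?_⟩, ?_⟩
      · rw [mem_sphere_zero_iff_norm, norm_smul, norm_inv, norm_norm, inv_mul_cancel₀ h0]
      · simp [smul_smul, h0]
  have h1 := hA i x hx u
  have h2 := hA i x hx (-u)
  have ht : ‖y‖ / δ ≤ 1 := (div_le_one hδ).2 hy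
  have ht0 : 0 ≤ ‖y‖ / δ := by positivity
  have h3 := hX h1 h2 (a := (1 + ‖y‖ / δ) / 2) (b := (1 - ‖y‖ / δ) / 2)
    (by linarith) (by linarith) (by ring)
  convert h3 using 1
  nth_rw 1 [hu]
  have hδ' := hδ.ne'
  simp only [coe_neg_sphere, smul_add, smul_neg, smul_smul]
  match_scalars <;> field_simp <;> ring

theorem norm_deviate_sub_deviate (x : Profile d) (i : Fin n) (y z : Strat (d i)) :
    ‖deviate x i y - deviate x i z‖ = ‖y - z‖ := by
  rw [← sq_eq_sq₀ (norm_nonneg _) (norm_nonneg _), PiLp.norm_sq_eq_of_L2, Finset.sum_eq_single i]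
  · simp
  · intro j _ hj
    simp [deviate_of_ne x hj]
  · simp

theorem played_update (x : Profile d) (v : (i : Fin n) → USphere (d i)) (i : Fin n)
    (u : USphere (d i)) : played δ x (Function.update v i u) =
      deviate (played δ x v) i (x i + δ • (u : Strat (d i))) := by
  refine PiLp.ext fun j => ?_
  by_cases hj : j = i
  · subst hj; simp [played]
  · simp [played, deviate_of_ne, hj]

/-- With the directions of the others frozen at v, the ball estimate applies to the own cost as a
function of the own displacement. The reference gradient is taken at x, not at the frozen profile,
so the displacement of the others is counted in the same bound. -/
theorem norm_integral_gradEst_update_sub_le (hG : StandingAssumption X f α β r R)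
    (hd : ∀ i, 0 < d i) (hA : Admissible X δ) (hδ : 0 < δ) {x : Profile d}
    (hx : x ∈ shrunkSet X δ) (hxX : x ∈ jointSet X) (i : Fin n) (v : (i : Fin n) → USphere (d i)) :
    ‖∫ u, gradEst f δ x (Function.update v i u) i ∂(uniformSphere (d i)) -
      partialGrad X (f i) i x‖ ≤ β * (√(n : ℝ) * δ) := by
  have := isProbabilityMeasure_uniformSphere (hd i)
  have hβ := hG.β_nonneg
  have hp := hA.played_mem hx v
  have hmem : ∀ y : Strat (d i), ‖y‖ ≤ δ → x i + y ∈ X i := fun y hy =>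
    hA.add_mem hδ (hd i) (hG.convex i) (hx i) hy
  have hmem' : ∀ y ∈ Metric.ball (0 : Strat (d i)) δ, x i + y ∈ X i := fun y hy =>
    hmem y (mem_ball_zero_iff.1 hy).le
  have hadd : ∀ y, HasFDerivAt (fun y => x i + y) (ContinuousLinearMap.id ℝ (Strat (d i))) y :=
    fun y => (hasFDerivAt_id y).const_add (x i)
  have key := (rotationInvariant_uniformSphere (d i)).norm_smul_integral_sub_le
    (h := fun y => f i (deviate (played δ x v) i (x i + y)))
    (G := fun y => partialGrad X (f i) i (deviate (played δ x v) i (x i + y)))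
    (G₀ := partialGrad X (f i) i x) (B := β * (√(n : ℝ) * δ)) hδ ?_ ?_ ?_ ?_ (by simpa using hd i)
  · simpa only [gradEst, played_update, Function.update_self, finrank_euclideanSpace,
      Fintype.card_fin, mul_smul, integral_smul] using key
  · exact (hG.contDiffOn i _ hp).continuousOn.comp (by fun_prop)
      fun y hy => hmem y (mem_closedBall_zero_iff.1 hy)
  · intro y hy
    have h1 := (hG.hasGradientWithinAt_deviate hp (hmem' y hy)).hasFDerivWithinAt
    -- The open δ-ball around xᵢ lies in Xᵢ, so at its points the gradient within Xᵢ is a genuine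
    -- gradient.
    have hnb : X i ∈ nhds (x i + y) := by
      refine Filter.mem_of_superset (Metric.isOpen_ball.mem_nhds (x := x i + y)
        (s := Metric.ball (x i) δ) (by simpa [mem_ball_iff_norm] using hy)) fun w hw => ?_
      have h2 := hmem (w - x i) (mem_ball_iff_norm.1 hw).le
      simpa using h2
    rw [hasGradientAt_iff_hasFDerivAt]
    simpa using! (h1.hasFDerivAt hnb).comp y (hadd y)
  · refine (LipschitzOnWith.of_dist_le_mul (K := β.toNNReal) fun y hy z hz => ?_).continuousOn
    rw [dist_eq_norm, dist_eq_norm, Real.coe_toNNReal _ hβ]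
    refine (hG.grad_lipschitz i _ (deviate_mem hp (hmem' y hy)) _
      (deviate_mem hp (hmem' z hz))).trans (le_of_eq ?_)
    rw [norm_deviate_sub_deviate, add_sub_add_left_eq_sub]
  · intro y hy
    refine (hG.grad_lipschitz i _ (deviate_mem hp (hmem' y hy)) _ hxX).trans ?_
    -- Each of the n blocks has moved by at most δ, which gives √n δ in the joint norm.
    refine mul_le_mul_of_nonneg_left (norm_le_sqrt_mul_of_forall_norm_le hδ.le fun j => ?_) hβ
    by_cases hj : j = i
    · subst hj
      simpa using (mem_ball_zero_iff.1 hy).le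
    · simp [deviate_of_ne _ hj, played, norm_smul, abs_of_pos hδ]

theorem measurable_apply (i : Fin n) : Measurable fun x : Profile d => x i :=
  Continuous.measurable (PiLp.continuous_apply 2 _ i)

theorem measurable_played :
    Measurable fun p : Profile d × ((i : Fin n) → USphere (d i)) => played δ p.1 p.2 := by
  refine (PiLp.continuous_toLp 2 _).measurable.comp (measurable_pi_iff.2 fun i => ?_)
  have h1 : Measurable fun p : Profile d × ((i : Fin n) → USphere (d i)) => p.1 i :=
    (measurable_apply i).comp measurable_fst
  have h2 : Measurable fun p : Profile d × ((i : Fin n) → USphere (d i)) =>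
      (p.2 i : Strat (d i)) :=
    measurable_subtype_coe.comp ((measurable_pi_apply i).comp measurable_snd)
  exact h1.add (h2.const_smul δ)

theorem measurable_gradEst (hf : ∀ i, Measurable (f i)) (i : Fin n) :
    Measurable fun p : Profile d × ((i : Fin n) → USphere (d i)) => gradEst f δ p.1 p.2 i := by
  have h2 : Measurable fun p : Profile d × ((i : Fin n) → USphere (d i)) =>
      (p.2 i : Strat (d i)) :=
    measurable_subtype_coe.comp ((measurable_pi_apply i).comp measurable_snd)
  exact (((hf i).comp measurable_played).const_mul _).smul h2

/-- The costs, extended by zero outside of the strategy sets. -/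
def extendCost (X : (i : Fin n) → Set (Strat (d i))) (f : Fin n → Profile d → ℝ) :
    Fin n → Profile d → ℝ := fun i => (jointSet X).indicator (f i)

theorem measurable_extendCost (hX : ∀ i, IsClosed (X i))
    (hf : ∀ i, Measurable (fun x : jointSet X => f i x)) (i : Fin n) :
    Measurable (extendCost X f i) := by
  have hm := (isClosed_jointSet hX).measurableSet
  refine measurable_of_restrict_of_restrict_compl hm ?_ ?_
  · convert hf i using 2 with x
    simp [extendCost, x.2]
  · convert (measurable_const : Measurable fun _ : ((jointSet X)ᶜ : Set (Profile d)) => (0 : ℝ))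
      using 2 with x
    have : (x : Profile d) ∉ jointSet X := x.2
    simp [extendCost, this]

/-- Only admissible profiles are queried, so the extended costs give the same estimates. They are
measurable on the whole space, while f is only known to be measurable on the joint strategy set. -/
theorem gradEst_extendCost (hA : Admissible X δ) {x : Profile d} (hx : x ∈ shrunkSet X δ)
    (v : (i : Fin n) → USphere (d i)) : gradEst (extendCost X f) δ x v = gradEst f δ x v := by
  funext i
  simp [gradEst, extendCost, hA.played_mem hx v]

theorem norm_gradEst_sq_le (hG : StandingAssumption X f α β r R) (hA : Admissible X δ)
    {x : Profile d} (hx : x ∈ shrunkSet X δ) (v : (i : Fin n) → USphere (d i)) (i : Fin n) :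
    ‖gradEst f δ x v i‖ ^ 2 ≤ ((d i : ℝ) / δ) ^ 2 * Fstar X f := by
  rw [gradEst, norm_smul, mem_sphere_zero_iff_norm.1 (v i).2, mul_one, Real.norm_eq_abs, sq_abs,
    mul_pow]
  exact mul_le_mul_of_nonneg_left (hG.sq_abs_le_Fstar (hA.played_mem hx v) i) (sq_nonneg _)

/-- The joint law of the directions drawn in one round. -/
def directionLaw (d : Fin n → ℕ) : Measure ((i : Fin n) → USphere (d i)) :=
  Measure.pi fun i => uniformSphere (d i)

theorem isProbabilityMeasure_directionLaw (hd : ∀ i, 0 < d i) :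
    IsProbabilityMeasure (directionLaw d) := by
  have := fun i => isProbabilityMeasure_uniformSphere (hd i)
  unfold directionLaw
  infer_instance

theorem integrable_gradEst (hG : StandingAssumption X f α β r R)
    (hf : ∀ i, Measurable (fun x : jointSet X => f i x)) (hd : ∀ i, 0 < d i)
    (hA : Admissible X δ) {x : Profile d} (hx : x ∈ shrunkSet X δ) (i : Fin n) :
    Integrable (fun v => gradEst f δ x v i) (directionLaw d) := by
  have := isProbabilityMeasure_directionLaw hd
  have hm : Measurable fun v => gradEst f δ x v i := by
    have h := (measurable_gradEst (δ := δ) (measurable_extendCost hG.isClosed hf) i).comp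
      (measurable_prodMk_left (x := x))
    convert h using 2 with v
    simp [gradEst_extendCost hA hx v]
  refine Integrable.of_bound hm.aestronglyMeasurable (√(((d i : ℝ) / δ) ^ 2 * Fstar X f))
    (Filter.Eventually.of_forall fun v => ?_)
  exact Real.le_sqrt_of_sq_le (norm_gradEst_sq_le hG hA hx v i)

/-- The bias of the one-point gradient estimate. -/
theorem norm_integral_gradEst_sub_le (hG : StandingAssumption X f α β r R)
    (hf : ∀ i, Measurable (fun x : jointSet X => f i x)) (hd : ∀ i, 0 < d i)
    (hA : Admissible X δ) (hδ : 0 < δ) {x : Profile d} (hx : x ∈ shrunkSet X δ)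
    (hxX : x ∈ jointSet X) (i : Fin n) :
    ‖∫ v, gradEst f δ x v i ∂(directionLaw d) - partialGrad X (f i) i x‖ ≤
      β * (√(n : ℝ) * δ) := by
  have := fun i => isProbabilityMeasure_uniformSphere (hd i)
  have := isProbabilityMeasure_directionLaw hd
  have hint := integrable_gradEst hG hf hd hA hx i
  have hmp : ((directionLaw d).prod (uniformSphere (d i))).map
      (fun p => Function.update p.1 i p.2) = directionLaw d :=
    map_update_pi_prod (fun i => uniformSphere (d i)) i
  have hm : Measurable fun p : ((j : Fin n) → USphere (d j)) × USphere (d i) =>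
      Function.update p.1 i p.2 := measurable_update'
  have hint2 : Integrable (fun p : ((j : Fin n) → USphere (d j)) × USphere (d i) =>
      gradEst f δ x (Function.update p.1 i p.2) i) ((directionLaw d).prod (uniformSphere (d i))) :=
    Integrable.comp_measurable (g := fun v => gradEst f δ x v i)
      (f := fun p : ((j : Fin n) → USphere (d j)) × USphere (d i) =>
        Function.update p.1 i p.2) (by rwa [hmp]) hm
  -- Resampling the direction of player i leaves the joint law unchanged. This lets the own
  -- direction be averaged first, with the others fixed.
  have e : ∫ v, gradEst f δ x v i ∂(directionLaw d) =
      ∫ v, ∫ u, gradEst f δ x (Function.update v i u) i ∂(uniformSphere (d i)) ∂(directionLaw d) := by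
    rw [← integral_prod _ hint2]
    conv_lhs => rw [← hmp]
    rw [integral_map hm.aemeasurable (by rw [hmp]; exact hint.aestronglyMeasurable)]
  have e2 : partialGrad X (f i) i x = ∫ _, partialGrad X (f i) i x ∂(directionLaw d) := by simp
  rw [e, e2, ← integral_sub hint2.integral_prod_left (integrable_const _)]
  have h := norm_integral_le_of_norm_le_const (μ := directionLaw d)
    (Filter.Eventually.of_forall fun v =>
      norm_integral_gradEst_update_sub_le hG hd hA hδ hx hxX i v)
  simpa using h

end Estimator

/-! ### Drift of the mean estimate -/

section Bias

variable {X : (i : Fin n) → Set (Strat (d i))} {f : Fin n → Profile d → ℝ} {α β r R δ : ℝ}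

/-- The mean of the gradient estimates of all players. -/
def meanGrad (f : Fin n → Profile d → ℝ) (δ : ℝ) (x : Profile d) : Profile d :=
  WithLp.toLp 2 fun i => ∫ v, gradEst f δ x v i ∂(directionLaw d)

/-- The gradient estimates of all players, as a profile. -/
def jointEst (f : Fin n → Profile d → ℝ) (δ : ℝ) (x : Profile d)
    (v : (i : Fin n) → USphere (d i)) : Profile d :=
  WithLp.toLp 2 fun i => gradEst f δ x v i

/-- Player i contributes (dᵢ/δ)²F⋆, and ∑ dᵢ² ≤ (∑ dᵢ)². -/
theorem norm_jointEst_sq_le (hG : StandingAssumption X f α β r R) (hA : Admissible X δ)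
    {x : Profile d} (hx : x ∈ shrunkSet X δ) (v : (i : Fin n) → USphere (d i)) :
    ‖jointEst f δ x v‖ ^ 2 ≤ (((∑ i, d i : ℕ) : ℝ) / δ) ^ 2 * Fstar X f := by
  rw [PiLp.norm_sq_eq_of_L2]
  refine (Finset.sum_le_sum fun i _ => norm_gradEst_sq_le hG hA hx v i).trans ?_
  rw [← Finset.sum_mul]
  rcases Nat.eq_zero_or_pos n with h | h
  · subst h; simp
  · have hF : 0 ≤ Fstar X f :=
      (sq_nonneg _).trans (hG.sq_abs_le_Fstar hG.zero_mem_jointSet ⟨0, h⟩)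
    refine mul_le_mul_of_nonneg_right ?_ hF
    simp only [div_pow]
    rw [← Finset.sum_div]
    refine div_le_div_of_nonneg_right ?_ (sq_nonneg _)
    push_cast
    exact Finset.sum_sq_le_sq_sum_of_nonneg fun i _ => Nat.cast_nonneg _

theorem shrunkSet_subset (hG : StandingAssumption X f α β r R) (hδ0 : 0 ≤ δ) (hδ1 : δ ≤ 1) :
    shrunkSet X δ ⊆ jointSet X := by
  intro x hx i
  obtain ⟨y, hy, h⟩ := hx i
  have h1 := hG.convex i hy (hG.zero_mem i) (sub_nonneg.2 hδ1) hδ0 (by ring)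
  rw [smul_zero, add_zero] at h1
  rw [← h]
  exact h1

theorem shrunkSet_eq_smul (X : (i : Fin n) → Set (Strat (d i))) (δ : ℝ) {x : Profile d}
    (hx : x ∈ shrunkSet X δ) : ∃ y ∈ jointSet X, x = (1 - δ) • y := by
  choose y hy h using hx
  exact ⟨WithLp.toLp 2 y, hy, PiLp.ext fun i => (h i).symm⟩

theorem norm_meanGrad_sub_le (hG : StandingAssumption X f α β r R)
    (hf : ∀ i, Measurable (fun x : jointSet X => f i x)) (hd : ∀ i, 0 < d i)
    (hA : Admissible X δ) (hδ : 0 < δ) (hδ1 : δ ≤ 1) {x : Profile d} (hx : x ∈ shrunkSet X δ) :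
    ‖meanGrad f δ x - gameGrad X f x‖ ≤ δ * (β * n) := by
  have hβ := hG.β_nonneg
  have h : ∀ i, ‖(meanGrad f δ x - gameGrad X f x) i‖ ≤ β * (√(n : ℝ) * δ) := fun i =>
    norm_integral_gradEst_sub_le hG hf hd hA hδ hx (shrunkSet_subset hG hδ.le hδ1 hx) i
  calc ‖meanGrad f δ x - gameGrad X f x‖ ≤ √(n : ℝ) * (β * (√(n : ℝ) * δ)) :=
        norm_le_sqrt_mul_of_forall_norm_le (by positivity) h
    _ = δ * (β * (√(n : ℝ) * √(n : ℝ))) := by ring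
    _ = δ * (β * n) := by rw [Real.mul_self_sqrt (Nat.cast_nonneg n)]

/-- The mean estimate points towards the shrunken equilibrium, up to the bias. -/
theorem drift_le_inner_meanGrad (hG : StandingAssumption X f α β r R)
    (hf : ∀ i, Measurable (fun x : jointSet X => f i x)) (hd : ∀ i, 0 < d i)
    (hA : Admissible X δ) (hδ : 0 < δ) (hδ1 : δ ≤ 1) {xstar : Profile d} (hN : IsNash X f xstar)
    {x : Profile d} (hx : x ∈ shrunkSet X δ) :
    α / 2 * ‖x - (1 - δ) • xstar‖ ^ 2 - (δ * (β * n + β * √(n : ℝ) * R)) ^ 2 / (2 * α) ≤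
      inner ℝ (meanGrad f δ x) (x - (1 - δ) • xstar) := by
  obtain ⟨hs, hV⟩ := hG.isNash_iff.1 hN
  have hα := hG.α_pos
  have hβ := hG.β_nonneg
  set z : Profile d := (1 - δ) • xstar with hz
  have hzS : z ∈ shrunkSet X δ := fun i => smul_mem_smul_set (hs i)
  have hzX := shrunkSet_subset hG hδ.le hδ1 hzS
  have hxX := shrunkSet_subset hG hδ.le hδ1 hx
  have h1 := hG.strongly_monotone x hxX z hzX
  -- Both x and z are scaled feasible points, so x - z = (1-δ)(y - x⋆) and the variational
  -- inequality at x⋆ applies.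
  have h2 : 0 ≤ inner ℝ (gameGrad X f xstar) (x - z) := by
    obtain ⟨y, hy, rfl⟩ := shrunkSet_eq_smul X δ hx
    rw [hz, ← smul_sub, real_inner_smul_right]
    exact mul_nonneg (sub_nonneg.2 hδ1) (hV y hy)
  have hzx : ‖xstar - z‖ ≤ δ * R := by
    have : xstar - z = δ • xstar := by rw [hz, sub_smul, one_smul]; abel
    rw [this, norm_smul, Real.norm_eq_abs, abs_of_pos hδ]
    exact mul_le_mul_of_nonneg_left (hG.norm_le hs) hδ.le
  have h3 : inner ℝ (gameGrad X f xstar - gameGrad X f z) (x - z) ≤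
      δ * (β * √(n : ℝ) * R) * ‖x - z‖ := by
    refine (real_inner_le_norm _ _).trans (mul_le_mul_of_nonneg_right ?_ (norm_nonneg _))
    refine (hG.norm_gameGrad_sub_le hs hzX).trans ?_
    calc β * √(n : ℝ) * ‖xstar - z‖ ≤ β * √(n : ℝ) * (δ * R) := by gcongr
      _ = δ * (β * √(n : ℝ) * R) := by ring
  have h4 : -inner ℝ (meanGrad f δ x - gameGrad X f x) (x - z) ≤ δ * (β * n) * ‖x - z‖ := by
    refine (neg_le_abs _).trans ((abs_real_inner_le_norm _ _).trans ?_)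
    exact mul_le_mul_of_nonneg_right (norm_meanGrad_sub_le hG hf hd hA hδ hδ1 hx) (norm_nonneg _)
  rw [inner_sub_left] at h1 h3 h4
  set c := δ * (β * n + β * √(n : ℝ) * R) with hc
  have h5 : α * ‖x - z‖ ^ 2 - c * ‖x - z‖ ≤ inner ℝ (meanGrad f δ x) (x - z) := by
    rw [hc]; linarith
  refine le_trans ?_ h5
  -- Young's inequality, by completing the square.
  have h6 : α / 2 * ‖x - z‖ ^ 2 - c * ‖x - z‖ + c ^ 2 / (2 * α) =
      (α * ‖x - z‖ - c) ^ 2 / (2 * α) := by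
    field_simp
    ring
  have h7 : 0 ≤ (α * ‖x - z‖ - c) ^ 2 / (2 * α) := by positivity
  linarith

end Bias

/-! ### Feasibility, measurability and one step of the iteration -/

section Dynamics

variable {X : (i : Fin n) → Set (Strat (d i))} {f : Fin n → Profile d → ℝ} {α β r R δ : ℝ}
  {η : ℕ → ℝ} {x0 : Profile d}

theorem proj_shrunk_spec (hG : StandingAssumption X f α β r R) (δ : ℝ) (i : Fin n) :
    ((1 - δ) • X i).Nonempty ∧ IsClosed ((1 - δ) • X i) ∧ Convex ℝ ((1 - δ) • X i) :=
  ⟨⟨0, hG.zero_mem i |> fun h => ⟨0, h, smul_zero _⟩⟩,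
    isClosedMap_smul₀ (1 - δ) _ (hG.isClosed i), (hG.convex i).smul _⟩

theorem iterate_mem_shrunkSet (hG : StandingAssumption X f α β r R) (h0 : x0 ∈ shrunkSet X δ)
    (f' : Fin n → Profile d → ℝ) (w : ℕ → (i : Fin n) → USphere (d i)) (t : ℕ) :
    iterate X f' δ η x0 w t ∈ shrunkSet X δ := by
  cases t with
  | zero => exact h0
  | succ t =>
    intro i
    obtain ⟨h1, h2, h3⟩ := proj_shrunk_spec hG δ i
    exact (proj_spec h1 h2 h3 _).1

theorem iterate_extendCost (hG : StandingAssumption X f α β r R) (hA : Admissible X δ)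
    (h0 : x0 ∈ shrunkSet X δ) (w : ℕ → (i : Fin n) → USphere (d i)) (t : ℕ) :
    iterate X (extendCost X f) δ η x0 w t = iterate X f δ η x0 w t := by
  induction t with
  | zero => rfl
  | succ t ih =>
    simp only [iterate, ih, gradEst_extendCost hA (iterate_mem_shrunkSet hG h0 f w t)]

theorem measurable_iterate_of_measurable (hG : StandingAssumption X f α β r R)
    {f' : Fin n → Profile d → ℝ} (hf' : ∀ i, Measurable (f' i)) (t : ℕ) :
    Measurable fun w : ℕ → (i : Fin n) → USphere (d i) => iterate X f' δ η x0 w t := by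
  induction t with
  | zero => exact measurable_const
  | succ t ih =>
    refine (PiLp.continuous_toLp 2 _).measurable.comp (measurable_pi_iff.2 fun i => ?_)
    obtain ⟨h1, h2, h3⟩ := proj_shrunk_spec hG δ i
    refine (continuous_proj h1 h2 h3).measurable.comp (((measurable_apply i).comp ih).sub ?_)
    exact (((measurable_gradEst hf' i).comp (ih.prodMk (measurable_pi_apply t)))).const_smul (η t)

theorem measurable_iterate (hG : StandingAssumption X f α β r R)
    (hf : ∀ i, Measurable (fun x : jointSet X => f i x)) (hA : Admissible X δ)
    (h0 : x0 ∈ shrunkSet X δ) (t : ℕ) :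
    Measurable fun w : ℕ → (i : Fin n) → USphere (d i) => iterate X f δ η x0 w t := by
  simpa only [iterate_extendCost hG hA h0] using
    measurable_iterate_of_measurable (δ := δ) (η := η) (x0 := x0) hG
      (measurable_extendCost hG.isClosed hf) t

theorem iterate_congr {w w' : ℕ → (i : Fin n) → USphere (d i)} {t : ℕ}
    (h : ∀ s < t, w s = w' s) : iterate X f δ η x0 w t = iterate X f δ η x0 w' t := by
  induction t with
  | zero => rfl
  | succ t ih =>
    simp only [iterate, ih fun s hs => h s (hs.trans t.lt_succ_self), h t t.lt_succ_self]

theorem norm_iterate_succ_sub_sq_le (hG : StandingAssumption X f α β r R)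
    {z : Profile d} (hz : z ∈ shrunkSet X δ) (w : ℕ → (i : Fin n) → USphere (d i)) (t : ℕ) :
    ‖iterate X f δ η x0 w (t + 1) - z‖ ^ 2 ≤ ‖iterate X f δ η x0 w t - z‖ ^ 2 -
      2 * η t * inner ℝ (jointEst f δ (iterate X f δ η x0 w t) (w t)) (iterate X f δ η x0 w t - z) +
      η t ^ 2 * ‖jointEst f δ (iterate X f δ η x0 w t) (w t)‖ ^ 2 := by
  set x := iterate X f δ η x0 w t with hx
  set g := jointEst f δ x (w t) with hg
  have h1 : ‖iterate X f δ η x0 w (t + 1) - z‖ ^ 2 ≤ ‖x - η t • g - z‖ ^ 2 := by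
    rw [PiLp.norm_sq_eq_of_L2, PiLp.norm_sq_eq_of_L2]
    refine Finset.sum_le_sum fun i _ => pow_le_pow_left₀ (norm_nonneg _) ?_ 2
    obtain ⟨h1, h2, h3⟩ := proj_shrunk_spec hG δ i
    exact norm_proj_sub_le h1 h2 h3 _ (hz i)
  refine h1.trans (le_of_eq ?_)
  have e : x - η t • g - z = (x - z) - η t • g := by abel
  rw [e, norm_sub_sq_real, real_inner_smul_right, norm_smul, mul_pow, Real.norm_eq_abs, sq_abs,
    real_inner_comm]
  ring

end Dynamics

/-! ### Conditioning on the past through independence -/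

section Expectation

/-- Independence makes the joint law a product, so Fubini integrates out B with A frozen. It plays
the role of the conditional expectation given the past. -/
theorem integral_comp_prod_of_indepFun {Ω S T : Type*} [MeasurableSpace Ω] [MeasurableSpace S]
    [MeasurableSpace T] {P : Measure Ω} [IsProbabilityMeasure P] {A : Ω → S} {B : Ω → T}
    (hA : Measurable A) (hB : Measurable B) (hAB : IndepFun A B P) {Ψ : S × T → ℝ}
    (hΨ : Measurable Ψ) (hint : Integrable (fun ω => Ψ (A ω, B ω)) P) :
    Integrable (fun ω => ∫ b, Ψ (A ω, b) ∂(P.map B)) P ∧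
      ∫ ω, Ψ (A ω, B ω) ∂P = ∫ ω, ∫ b, Ψ (A ω, b) ∂(P.map B) ∂P := by
  have := Measure.isProbabilityMeasure_map (μ := P) hA.aemeasurable
  have := Measure.isProbabilityMeasure_map (μ := P) hB.aemeasurable
  have hlaw := (indepFun_iff_map_prod_eq_prod_map_map hA.aemeasurable hB.aemeasurable).1 hAB
  have hint' : Integrable Ψ ((P.map A).prod (P.map B)) := by
    rw [← hlaw]
    exact (integrable_map_measure hΨ.aestronglyMeasurable (hA.prodMk hB).aemeasurable).2 hint
  refine ⟨?_, ?_⟩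
  · exact (integrable_map_measure hint'.integral_prod_left.aestronglyMeasurable
      hA.aemeasurable).1 hint'.integral_prod_left
  · rw [← integral_map (f := fun a => ∫ b, Ψ (a, b) ∂(P.map B)) hA.aemeasurable
      hint'.integral_prod_left.aestronglyMeasurable, ← integral_prod _ hint', ← hlaw,
      integral_map (hA.prodMk hB).aemeasurable hΨ.aestronglyMeasurable]

variable {X : (i : Fin n) → Set (Strat (d i))} {f : Fin n → Profile d → ℝ} {α β r R δ : ℝ}
  {η : ℕ → ℝ} {x0 : Profile d}
  {Ω : Type*} [MeasurableSpace Ω] {P : Measure Ω}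
  {v : ℕ → (i : Fin n) → Ω → USphere (d i)}

theorem map_directions_eq (hv_meas : ∀ t i, Measurable (v t i))
    (hv_law : ∀ t i, P.map (v t i) = uniformSphere (d i))
    (hv_indep : iIndepFun (fun p : ℕ × Fin n => v p.1 p.2) P) (t : ℕ) :
    P.map (fun ω i => v t i ω) = directionLaw d := by
  have h : iIndepFun (fun i => v t i) P :=
    hv_indep.precomp (g := fun i : Fin n => (t, i)) fun i j h => (Prod.ext_iff.1 h).2
  rw [h.map_fun_eq_pi_map fun i => (hv_meas t i).aemeasurable]
  simp only [hv_law, directionLaw]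

/-- The iterate at time t is a function of the draws of rounds s < t only, a block of indices
disjoint from that of round t. -/
theorem indepFun_iterate [IsProbabilityMeasure P] (hG : StandingAssumption X f α β r R)
    (hf : ∀ i, Measurable (fun x : jointSet X => f i x)) (hA : Admissible X δ)
    (h0 : x0 ∈ shrunkSet X δ) (hv_meas : ∀ t i, Measurable (v t i))
    (hv_indep : iIndepFun (fun p : ℕ × Fin n => v p.1 p.2) P) (t : ℕ) :
    IndepFun (fun ω => iterate X f δ η x0 (fun s i => v s i ω) t) (fun ω i => v t i ω) P := by
  classical
  obtain ⟨ω₀⟩ : Nonempty Ω := nonempty_of_isProbabilityMeasure P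
  let S : Finset (ℕ × Fin n) := Finset.range t ×ˢ Finset.univ
  let T : Finset (ℕ × Fin n) := {t} ×ˢ Finset.univ
  have hST : Disjoint S T := by
    rw [Finset.disjoint_left]
    rintro ⟨s, i⟩ hs ht
    simp only [S, T, Finset.mem_product, Finset.mem_range, Finset.mem_singleton] at hs ht
    omega
  have hmT : ∀ i, (t, i) ∈ T := fun i => by simp [T]
  have h := hv_indep.indepFun_finset S T hST fun p => hv_meas p.1 p.2
  -- Finitely many draws are completed to a full sequence by arbitrary constants, the values at ω₀.
  -- By `iterate_congr` the entries from round t on do not affect the iterate.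
  let ext : ((p : S) → USphere (d p.1.2)) → ℕ → (i : Fin n) → USphere (d i) := fun a s i =>
    if hs : (s, i) ∈ S then a ⟨(s, i), hs⟩ else v s i ω₀
  have hext : Measurable ext := by
    refine measurable_pi_iff.2 fun s => measurable_pi_iff.2 fun i => ?_
    by_cases hs : (s, i) ∈ S
    · simpa only [ext, hs, dite_true] using measurable_pi_apply (⟨(s, i), hs⟩ : S)
    · simp only [ext, hs, dite_false]
      exact measurable_const
  have h2 := h.comp ((measurable_iterate (η := η) hG hf hA h0 t).comp hext)
    (measurable_pi_iff.2 fun i => measurable_pi_apply (⟨(t, i), hmT i⟩ : T))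
  refine h2.congr (Filter.Eventually.of_forall fun ω => ?_)
    (Filter.Eventually.of_forall fun ω => rfl)
  refine iterate_congr fun s hs => ?_
  funext i
  have : (s, i) ∈ S := by simp [S, hs]
  simp only [ext, this, dite_true]

end Expectation

/-! ### The expected one-step inequality and its scalar recursion -/

section Recursion

variable {X : (i : Fin n) → Set (Strat (d i))} {f : Fin n → Profile d → ℝ} {α β r R δ : ℝ}
  {η : ℕ → ℝ} {x0 : Profile d}
  {Ω : Type*} [MeasurableSpace Ω] {P : Measure Ω} [IsProbabilityMeasure P]
  {v : ℕ → (i : Fin n) → Ω → USphere (d i)}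

theorem measurable_iterate_comp (hG : StandingAssumption X f α β r R)
    (hf : ∀ i, Measurable (fun x : jointSet X => f i x)) (hA : Admissible X δ)
    (h0 : x0 ∈ shrunkSet X δ) (hv_meas : ∀ t i, Measurable (v t i)) (t : ℕ) :
    Measurable fun ω => iterate X f δ η x0 (fun s i => v s i ω) t :=
  (measurable_iterate hG hf hA h0 t).comp
    (measurable_pi_iff.2 fun s => measurable_pi_iff.2 fun i => hv_meas s i)

theorem norm_le_of_mem_shrunkSet (hG : StandingAssumption X f α β r R) {x : Profile d}
    (hx : x ∈ shrunkSet X δ) : ‖x‖ ≤ |1 - δ| * R := by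
  obtain ⟨y, hy, rfl⟩ := shrunkSet_eq_smul X δ hx
  rw [norm_smul, Real.norm_eq_abs]
  exact mul_le_mul_of_nonneg_left (hG.norm_le hy) (abs_nonneg _)

theorem norm_iterate_sub_le (hG : StandingAssumption X f α β r R)
    (h0 : x0 ∈ shrunkSet X δ) (w : ℕ → (i : Fin n) → USphere (d i)) (t : ℕ) (z : Profile d) :
    ‖iterate X f δ η x0 w t - z‖ ≤ |1 - δ| * R + ‖z‖ :=
  (norm_sub_le _ _).trans
    (add_le_add_left (norm_le_of_mem_shrunkSet hG (iterate_mem_shrunkSet hG h0 f w t)) _)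

theorem integrable_norm_iterate_sub_sq (hG : StandingAssumption X f α β r R)
    (hf : ∀ i, Measurable (fun x : jointSet X => f i x)) (hA : Admissible X δ)
    (h0 : x0 ∈ shrunkSet X δ) (hv_meas : ∀ t i, Measurable (v t i)) (t : ℕ) (z : Profile d) :
    Integrable (fun ω => ‖iterate X f δ η x0 (fun s i => v s i ω) t - z‖ ^ 2) P := by
  refine Integrable.of_bound (((measurable_iterate_comp hG hf hA h0 hv_meas t).sub_const
    z).norm.pow_const 2).aestronglyMeasurable ((|1 - δ| * R + ‖z‖) ^ 2)
    (Filter.Eventually.of_forall fun ω => ?_)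
  rw [norm_pow, norm_norm]
  exact pow_le_pow_left₀ (norm_nonneg _) (norm_iterate_sub_le hG h0 _ t z) 2

theorem integral_inner_jointEst (hG : StandingAssumption X f α β r R)
    (hf : ∀ i, Measurable (fun x : jointSet X => f i x)) (hd : ∀ i, 0 < d i)
    (hA : Admissible X δ) {x : Profile d} (hx : x ∈ shrunkSet X δ) (y : Profile d) :
    ∫ w, inner ℝ (jointEst f δ x w) y ∂(directionLaw d) = inner ℝ (meanGrad f δ x) y := by
  have hint := fun i => integrable_gradEst hG hf hd hA hx i
  have e : ∀ a b : Profile d, inner ℝ a b = ∑ i, inner ℝ (a i) (b i) :=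
    fun a b => PiLp.inner_apply a b
  simp only [e]
  rw [integral_finsetSum]
  · refine Finset.sum_congr rfl fun i _ => ?_
    simp only [jointEst, meanGrad]
    rw [real_inner_comm, ← integral_inner (hint i)]
    simp only [real_inner_comm]
  · intro i _
    exact (hint i).inner_const (𝕜 := ℝ) (y i)

/-- The expected inner product of the estimate with the distance to a fixed profile. -/
theorem integral_inner_jointEst_iterate (hG : StandingAssumption X f α β r R)
    (hf : ∀ i, Measurable (fun x : jointSet X => f i x)) (hd : ∀ i, 0 < d i)
    (hA : Admissible X δ) (h0 : x0 ∈ shrunkSet X δ) (hv_meas : ∀ t i, Measurable (v t i))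
    (hv_law : ∀ t i, P.map (v t i) = uniformSphere (d i))
    (hv_indep : iIndepFun (fun p : ℕ × Fin n => v p.1 p.2) P) (t : ℕ) (z : Profile d) :
    let x := fun ω => iterate X f δ η x0 (fun s i => v s i ω) t
    Integrable (fun ω => inner ℝ (jointEst f δ (x ω) fun i => v t i ω) (x ω - z)) P ∧
    Integrable (fun ω => inner ℝ (meanGrad f δ (x ω)) (x ω - z)) P ∧
    ∫ ω, inner ℝ (jointEst f δ (x ω) fun i => v t i ω) (x ω - z) ∂P =
      ∫ ω, inner ℝ (meanGrad f δ (x ω)) (x ω - z) ∂P := by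
  intro x
  have hxS : ∀ ω, x ω ∈ shrunkSet X δ := fun ω => iterate_mem_shrunkSet hG h0 f _ t
  have hxm : Measurable x := measurable_iterate_comp hG hf hA h0 hv_meas t
  have hvm : Measurable fun ω i => v t i ω := measurable_pi_iff.2 fun i => hv_meas t i
  let Ψ : Profile d × ((i : Fin n) → USphere (d i)) → ℝ := fun p =>
    inner ℝ (jointEst (extendCost X f) δ p.1 p.2) (p.1 - z)
  have hΨm : Measurable Ψ := by
    refine Measurable.inner ?_ (measurable_fst.sub_const z)
    refine (PiLp.continuous_toLp 2 _).measurable.comp (measurable_pi_iff.2 fun i => ?_)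
    exact measurable_gradEst (measurable_extendCost hG.isClosed hf) i
  have hΨ : ∀ ω w, Ψ (x ω, w) = inner ℝ (jointEst f δ (x ω) w) (x ω - z) := fun ω w => by
    simp only [Ψ, jointEst, gradEst_extendCost hA (hxS ω)]
  have hint : Integrable (fun ω => Ψ (x ω, fun i => v t i ω)) P := by
    refine Integrable.of_bound (hΨm.comp (hxm.prodMk hvm)).aestronglyMeasurable
      (√((((∑ i, d i : ℕ) : ℝ) / δ) ^ 2 * Fstar X f) * (|1 - δ| * R + ‖z‖))
      (Filter.Eventually.of_forall fun ω => ?_)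
    rw [hΨ, Real.norm_eq_abs]
    refine (abs_real_inner_le_norm _ _).trans (mul_le_mul ?_ (norm_iterate_sub_le hG h0 _ t z)
      (norm_nonneg _) (Real.sqrt_nonneg _))
    exact Real.le_sqrt_of_sq_le (norm_jointEst_sq_le hG hA (hxS ω) _)
  have h := integral_comp_prod_of_indepFun hxm hvm
    (indepFun_iterate hG hf hA h0 hv_meas hv_indep t) hΨm hint
  simp only [hΨ, map_directions_eq hv_meas hv_law hv_indep,
    fun ω => integral_inner_jointEst hG hf hd hA (hxS ω) (x ω - z)] at h hint
  exact ⟨hint, h⟩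

/-- The expected one-step progress towards the shrunken equilibrium. -/
theorem integral_norm_iterate_succ_sub_sq_le (hG : StandingAssumption X f α β r R)
    (hf : ∀ i, Measurable (fun x : jointSet X => f i x)) (hd : ∀ i, 0 < d i)
    (hA : Admissible X δ) (hδ : 0 < δ) (hδ1 : δ ≤ 1) (h0 : x0 ∈ shrunkSet X δ)
    (hv_meas : ∀ t i, Measurable (v t i))
    (hv_law : ∀ t i, P.map (v t i) = uniformSphere (d i))
    (hv_indep : iIndepFun (fun p : ℕ × Fin n => v p.1 p.2) P)
    {xstar : Profile d} (hN : IsNash X f xstar) {t : ℕ} (hη : 0 ≤ η t) :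
    ∫ ω, ‖iterate X f δ η x0 (fun s i => v s i ω) (t + 1) - (1 - δ) • xstar‖ ^ 2 ∂P ≤
      (1 - η t * α) *
        ∫ ω, ‖iterate X f δ η x0 (fun s i => v s i ω) t - (1 - δ) • xstar‖ ^ 2 ∂P +
      η t * ((δ * (β * n + β * √(n : ℝ) * R)) ^ 2 / α) +
      η t ^ 2 * ((((∑ i, d i : ℕ) : ℝ) / δ) ^ 2 * Fstar X f) := by
  set z : Profile d := (1 - δ) • xstar with hz
  set c := δ * (β * n + β * √(n : ℝ) * R) with hc
  set V := (((∑ i, d i : ℕ) : ℝ) / δ) ^ 2 * Fstar X f with hV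
  have hα := hG.α_pos
  have hzS : z ∈ shrunkSet X δ := fun i => smul_mem_smul_set (hN.1 i)
  let x := fun ω => iterate X f δ η x0 (fun s i => v s i ω) t
  have hxS : ∀ ω, x ω ∈ shrunkSet X δ := fun ω => iterate_mem_shrunkSet hG h0 f _ t
  have hsq := fun t => integrable_norm_iterate_sub_sq (P := P) (η := η) hG hf hA h0 hv_meas t z
  have hx2 : Integrable (fun ω => ‖x ω - z‖ ^ 2) P := hsq t
  obtain ⟨hi1, hi2, he⟩ :
      Integrable (fun ω => inner ℝ (jointEst f δ (x ω) fun i => v t i ω) (x ω - z)) P ∧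
      Integrable (fun ω => inner ℝ (meanGrad f δ (x ω)) (x ω - z)) P ∧
      ∫ ω, inner ℝ (jointEst f δ (x ω) fun i => v t i ω) (x ω - z) ∂P =
        ∫ ω, inner ℝ (meanGrad f δ (x ω)) (x ω - z) ∂P :=
    integral_inner_jointEst_iterate (η := η) hG hf hd hA h0 hv_meas hv_law hv_indep t z
  have hi3 : Integrable (fun ω => α / 2 * ‖x ω - z‖ ^ 2 - c ^ 2 / (2 * α)) P :=
    (hx2.const_mul _).sub (integrable_const _)
  have hi4 : Integrable (fun ω => ‖x ω - z‖ ^ 2 -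
      2 * η t * inner ℝ (jointEst f δ (x ω) fun i => v t i ω) (x ω - z)) P :=
    hx2.sub (hi1.const_mul _)
  -- The pointwise drift inequality is integrated over the past; `he` has already replaced the
  -- estimate by its mean.
  have hdrift : α / 2 * ∫ ω, ‖x ω - z‖ ^ 2 ∂P - c ^ 2 / (2 * α) ≤
      ∫ ω, inner ℝ (meanGrad f δ (x ω)) (x ω - z) ∂P := by
    have h := integral_mono hi3 hi2 fun ω =>
      drift_le_inner_meanGrad hG hf hd hA hδ hδ1 hN (hxS ω)
    rw [integral_sub (hx2.const_mul _) (integrable_const _), integral_const_mul] at h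
    simpa using h
  have hstep : ∫ ω, ‖iterate X f δ η x0 (fun s i => v s i ω) (t + 1) - z‖ ^ 2 ∂P ≤
      ∫ ω, (‖x ω - z‖ ^ 2 -
        2 * η t * inner ℝ (jointEst f δ (x ω) fun i => v t i ω) (x ω - z) + η t ^ 2 * V) ∂P := by
    refine integral_mono (hsq (t + 1))
      (hi4.add (integrable_const _)) fun ω => ?_
    refine (norm_iterate_succ_sub_sq_le hG hzS _ t).trans (add_le_add_right ?_ _)
    exact mul_le_mul_of_nonneg_left (norm_jointEst_sq_le hG hA (hxS ω) _) (sq_nonneg _)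
  rw [integral_add hi4 (integrable_const _), integral_sub hx2 (hi1.const_mul _), integral_const_mul, he] at hstep
  have h1 := mul_le_mul_of_nonneg_left hdrift (mul_nonneg zero_le_two hη)
  have h2 : 2 * η t * (α / 2 * ∫ ω, ‖x ω - z‖ ^ 2 ∂P - c ^ 2 / (2 * α)) =
      η t * α * ∫ ω, ‖x ω - z‖ ^ 2 ∂P - η t * (c ^ 2 / α) := by
    field_simp
  simp only [integral_const, probReal_univ, smul_eq_mul, one_mul] at hstep
  change _ ≤ (1 - η t * α) * ∫ ω, ‖x ω - z‖ ^ 2 ∂P + _ + _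
  linarith

/-- The stationary part q reproduces itself, since (1 - 2/t)q + (2/t)q = q. The values at t = 1 and
t = 2 come from the a priori bound M ≤ K/2: at t = 1 the factor 1 - 2/t is negative and no bound
could be propagated through it. -/
theorem le_div_add_of_recursion {a : ℕ → ℝ} {M q V K : ℝ} (hM : ∀ t, a t ≤ M) (hq : 0 ≤ q)
    (hKM : 2 * M ≤ K) (hK0 : 0 ≤ K) (hKV : V ≤ K)
    (hrec : ∀ t : ℕ, 1 ≤ t → a (t + 1) ≤ (1 - 2 / t) * a t + 2 / t * q + V / t ^ 2)
    {t : ℕ} (ht : 1 ≤ t) : a t ≤ K / t + q := by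
  rcases ht.eq_or_lt with rfl | ht2
  · have := hM 1
    simp only [Nat.cast_one, div_one]
    linarith
  · replace ht2 : 2 ≤ t := ht2
    clear ht
    induction t, ht2 using Nat.le_induction with
    | base =>
      have := hM 2
      push_cast
      linarith
    | succ t ht ih =>
      have ht' : (2 : ℝ) ≤ t := by exact_mod_cast ht
      have ht0 : (0 : ℝ) < t := by linarith
      have h1 := hrec t (by omega)
      have h2 : 0 ≤ 1 - 2 / (t : ℝ) := by
        rw [sub_nonneg, div_le_one ht0]
        exact ht'
      have h3 := mul_le_mul_of_nonneg_left ih h2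
      have h4 : V / (t : ℝ) ^ 2 ≤ K / (t : ℝ) ^ 2 := div_le_div_of_nonneg_right hKV (by positivity)
      -- This reduces to (t-1)/t² ≤ 1/(t+1), that is, t² - 1 ≤ t².
      have h5 : (1 - 2 / (t : ℝ)) * (K / t) + K / (t : ℝ) ^ 2 ≤ K / ((t + 1 : ℕ) : ℝ) := by
        have e : (1 - 2 / (t : ℝ)) * (K / t) + K / (t : ℝ) ^ 2 = K * ((t - 1) / (t : ℝ) ^ 2) := by
          field_simp
          ring
        rw [e, div_eq_mul_inv K]
        refine mul_le_mul_of_nonneg_left ?_ hK0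
        push_cast
        rw [inv_eq_one_div, div_le_div_iff₀ (by positivity) (by positivity)]
        nlinarith
      have h6 : (1 - 2 / (t : ℝ)) * q + 2 / t * q = q := by ring
      have h7 := mul_add (1 - 2 / (t : ℝ)) (K / t) q
      linarith

end Recursion

/-! ### The convergence rate and the choice of constants -/

section Rate

variable {X : (i : Fin n) → Set (Strat (d i))} {f : Fin n → Profile d → ℝ} {α β r R δ : ℝ}
  {η : ℕ → ℝ} {x0 : Profile d}
  {Ω : Type*} [MeasurableSpace Ω] {P : Measure Ω} [IsProbabilityMeasure P]
  {v : ℕ → (i : Fin n) → Ω → USphere (d i)}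

/-- Convergence to the shrunken equilibrium at rate `1 / t`, up to the squared bias. -/
theorem integral_norm_iterate_sub_shrunk_sq_le (hG : StandingAssumption X f α β r R)
    (hf : ∀ i, Measurable (fun x : jointSet X => f i x)) (hd : ∀ i, 0 < d i)
    (hA : Admissible X δ) (hδ : 0 < δ) (hδ1 : δ ≤ 1) (h0 : x0 ∈ shrunkSet X δ)
    (hv_meas : ∀ t i, Measurable (v t i))
    (hv_law : ∀ t i, P.map (v t i) = uniformSphere (d i))
    (hv_indep : iIndepFun (fun p : ℕ × Fin n => v p.1 p.2) P)
    {xstar : Profile d} (hN : IsNash X f xstar) (hη : ∀ t : ℕ, 1 ≤ t → η t = 2 / (α * t))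
    {t : ℕ} (ht : 1 ≤ t) :
    ∫ ω, ‖iterate X f δ η x0 (fun s i => v s i ω) t - (1 - δ) • xstar‖ ^ 2 ∂P ≤
      max (8 * R ^ 2) (4 * ((((∑ i, d i : ℕ) : ℝ) / δ) ^ 2 * Fstar X f) / α ^ 2) / t +
      (δ * (β * n + β * √(n : ℝ) * R) / α) ^ 2 := by
  have hα := hG.α_pos
  have hR := hG.R_pos
  have hzS : (1 - δ) • xstar ∈ shrunkSet X δ := fun i => smul_mem_smul_set (hN.1 i)
  have hR1 : |1 - δ| * R ≤ R := by
    rw [abs_of_nonneg (sub_nonneg.2 hδ1)]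
    nlinarith
  -- Iterates and target both have norm at most R, so M = (2R)² and 2M = 8R². Substituting ηₜ =
  -- 2/(αt) gives the contraction factor 1 - 2/t.
  refine le_div_add_of_recursion (M := (2 * R) ^ 2)
    (a := fun t => ∫ ω, ‖iterate X f δ η x0 (fun s i => v s i ω) t - (1 - δ) • xstar‖ ^ 2 ∂P)
    (V := 4 * ((((∑ i, d i : ℕ) : ℝ) / δ) ^ 2 * Fstar X f) / α ^ 2)
    (fun t => ?_) (sq_nonneg _) ?_ (le_max_of_le_left (by positivity)) (le_max_right _ _)
    (fun t ht => ?_) ht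
  · have h := integral_mono (integrable_norm_iterate_sub_sq (P := P) (η := η) hG hf hA h0 hv_meas t
      ((1 - δ) • xstar)) (integrable_const ((2 * R) ^ 2)) fun ω => by
        refine pow_le_pow_left₀ (norm_nonneg _) ?_ 2
        have h1 := norm_iterate_sub_le (η := η) (f := f) hG h0 (fun s i => v s i ω) t
          ((1 - δ) • xstar)
        have h2 := norm_le_of_mem_shrunkSet hG hzS
        linarith
    simpa using h
  · refine le_trans (le_of_eq ?_) (le_max_left _ _)
    ring
  · have ht0 : (0 : ℝ) < t := by exact_mod_cast ht
    have hηt := hη t ht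
    have hη0 : 0 ≤ η t := by rw [hηt]; positivity
    refine (integral_norm_iterate_succ_sub_sq_le hG hf hd hA hδ hδ1 h0 hv_meas hv_law hv_indep hN
      hη0).trans (le_of_eq ?_)
    have e1 : η t * α = 2 / t := by rw [hηt]; field_simp
    have e2 : η t * ((δ * (β * n + β * √(n : ℝ) * R)) ^ 2 / α) =
        2 / t * (δ * (β * n + β * √(n : ℝ) * R) / α) ^ 2 := by
      rw [hηt, div_pow]; field_simp
    have e3 : η t ^ 2 * ((((∑ i, d i : ℕ) : ℝ) / δ) ^ 2 * Fstar X f) =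
        4 * ((((∑ i, d i : ℕ) : ℝ) / δ) ^ 2 * Fstar X f) / α ^ 2 / t ^ 2 := by
      rw [hηt, div_pow, mul_pow]; ring
    rw [e1, e2, e3]

theorem integral_norm_iterate_sub_sq_le (hn : 0 < n) (hG : StandingAssumption X f α β r R)
    (hf : ∀ i, Measurable (fun x : jointSet X => f i x)) (hd : ∀ i, 0 < d i)
    (hA : Admissible X δ) (h0 : x0 ∈ shrunkSet X δ)
    (hv_meas : ∀ t i, Measurable (v t i))
    (hv_law : ∀ t i, P.map (v t i) = uniformSphere (d i))
    (hv_indep : iIndepFun (fun p : ℕ × Fin n => v p.1 p.2) P)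
    {xstar : Profile d} (hN : IsNash X f xstar) (hη : ∀ t : ℕ, 1 ≤ t → η t = 2 / (α * t))
    {ε : ℝ} (hε : 0 < ε) (hδ : δ = α * √(ε / 4) / gameConst n α β R) {t : ℕ}
    (ht : max (32 * α ^ 4 * ε * R ^ 2)
      (64 * gameConst n α β R ^ 2 * Fstar X f * ((∑ i, d i : ℕ) : ℝ) ^ 2 * n) /
        (α ^ 4 * ε ^ 2) ≤ (t : ℝ)) :
    ∫ ω, ‖iterate X f δ η x0 (fun s i => v s i ω) t - xstar‖ ^ 2 ∂P ≤ ε := by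
  have hα := hG.α_pos
  have hβ := hG.β_nonneg
  have hR := hG.R_pos
  set C := gameConst n α β R with hC
  have hCR : α * R ≤ C := by
    have : C = α * R + (β * √(n : ℝ) * R + β * n) := by rw [hC, gameConst]; ring
    rw [this]
    have : 0 ≤ β * √(n : ℝ) * R + β * n := by positivity
    linarith
  have hC0 : 0 < C := (mul_pos hα hR).trans_le hCR
  set q := √(ε / 4) with hq
  have hq0 : 0 < q := Real.sqrt_pos.2 (by positivity)
  have hq2 : q ^ 2 = ε / 4 := Real.sq_sqrt (by positivity)
  have hδ0 : 0 < δ := by rw [hδ]; positivity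
  have hδC : δ * C = α * q := by rw [hδ]; field_simp
  have hδR : δ * R ≤ q := by
    refine le_of_mul_le_mul_left ?_ hα
    calc α * (δ * R) = δ * (α * R) := by ring
      _ ≤ δ * C := by gcongr
      _ = α * q := hδC
  have hsR : ‖xstar‖ ≤ R := hG.norm_le hN.1
  have hint := integrable_norm_iterate_sub_sq (P := P) (η := η) hG hf hA h0 hv_meas t
  rcases le_total δ 1 with hδ1 | hδ1
  · have ht0 : (0 : ℝ) < t := by
      refine lt_of_lt_of_le ?_ ht
      exact div_pos (lt_max_of_lt_left (by positivity)) (by positivity)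
    have ht1 : 1 ≤ t := by exact_mod_cast ht0
    have h := integral_norm_iterate_sub_shrunk_sq_le hG hf hd hA hδ0 hδ1 h0 hv_meas hv_law hv_indep
      hN hη ht1
    set s := δ * (β * n + β * √(n : ℝ) * R) / α with hs
    have hs0 : 0 ≤ s := by positivity
    set ρ := δ * R with hρ
    have hρ0 : 0 ≤ ρ := by positivity
    -- This is what C is made for: the bias radius s plus the shrinkage radius ρ is exactly δC/α =
    -- √(ε/4).
    have hsρ : s + ρ = q := by
      have : s + ρ = δ * C / α := by
        rw [hs, hρ, hC, gameConst]; field_simp; ring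
      rw [this, hδC]; field_simp
    have hF : 0 ≤ Fstar X f :=
      (sq_nonneg _).trans (hG.sq_abs_le_Fstar hG.zero_mem_jointSet ⟨0, hn⟩)
    -- The two terms of the threshold on t match the two terms of the maximum, up to a spare factor
    -- n ≥ 1 in the second.
    have hK : max (8 * R ^ 2) (4 * ((((∑ i, d i : ℕ) : ℝ) / δ) ^ 2 * Fstar X f) / α ^ 2) / t ≤
        q ^ 2 := by
      rw [div_le_iff₀ (by positivity), max_le_iff] at ht
      rw [div_le_iff₀ ht0, hq2]
      refine max_le ?_ ?_
      · have h1 : 0 < 4 * α ^ 4 * ε := by positivity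
        refine le_of_mul_le_mul_left ?_ h1
        linarith [ht.1]
      · have e : 4 * ((((∑ i, d i : ℕ) : ℝ) / δ) ^ 2 * Fstar X f) / α ^ 2 =
            16 * C ^ 2 * Fstar X f * ((∑ i, d i : ℕ) : ℝ) ^ 2 / (α ^ 4 * ε) := by
          have hδ2 : δ ^ 2 = α ^ 2 * (ε / 4) / C ^ 2 := by
            rw [hδ, div_pow, mul_pow, hq2]
          rw [div_pow, hδ2]
          field_simp
          ring
        rw [e, div_le_iff₀ (by positivity)]
        have hn1 : (1 : ℝ) ≤ n := by exact_mod_cast hn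
        have h1 : 64 * C ^ 2 * Fstar X f * ((∑ i, d i : ℕ) : ℝ) ^ 2 * 1 ≤
            64 * C ^ 2 * Fstar X f * ((∑ i, d i : ℕ) : ℝ) ^ 2 * n :=
          mul_le_mul_of_nonneg_left hn1 (by positivity)
        linarith [ht.2]
    -- An upper bound for the L² distance to z, as q² + s² ≤ (q + s)². The weight ρ/m in `hpt` is
    -- the optimal one in 2ρu ≤ (ρ/m)u² + ρm: at second moment m² it returns exactly (m + ρ)², in
    -- place of Minkowski's inequality.
    set m := q + s with hm
    have hm0 : 0 < m := by positivity
    have hEm : ∫ ω, ‖iterate X f δ η x0 (fun s i => v s i ω) t - (1 - δ) • xstar‖ ^ 2 ∂P ≤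
        m ^ 2 := by
      refine h.trans ((add_le_add_left hK _).trans ?_)
      rw [hm]
      nlinarith [mul_nonneg hq0.le hs0]
    have hpt : ∀ ω, ‖iterate X f δ η x0 (fun s i => v s i ω) t - xstar‖ ^ 2 ≤
        (1 + ρ / m) * ‖iterate X f δ η x0 (fun s i => v s i ω) t - (1 - δ) • xstar‖ ^ 2 +
          (ρ ^ 2 + ρ * m) := by
      intro ω
      set x := iterate X f δ η x0 (fun s i => v s i ω) t
      set u := ‖x - (1 - δ) • xstar‖ with hu
      have h1 : ‖x - xstar‖ ≤ u + ρ := by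
        have e : x - xstar = (x - (1 - δ) • xstar) - δ • xstar := by
          rw [sub_smul, one_smul]; abel
        rw [e]
        refine (norm_sub_le _ _).trans (add_le_add_right ?_ _)
        rw [norm_smul, Real.norm_eq_abs, abs_of_pos hδ0]
        exact mul_le_mul_of_nonneg_left hsR hδ0.le
      refine (pow_le_pow_left₀ (norm_nonneg _) h1 2).trans ?_
      have e : (1 + ρ / m) * u ^ 2 + (ρ ^ 2 + ρ * m) = (u + ρ) ^ 2 + ρ / m * (u - m) ^ 2 := by
        field_simp
        ring
      rw [e]
      have : 0 ≤ ρ / m * (u - m) ^ 2 := by positivity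
      linarith
    have h2 := integral_mono (hint xstar)
      (((hint ((1 - δ) • xstar)).const_mul (1 + ρ / m)).add (integrable_const (ρ ^ 2 + ρ * m))) hpt
    refine h2.trans ?_
    have e3 : ∫ ω, ((1 + ρ / m) *
        ‖iterate X f δ η x0 (fun s i => v s i ω) t - (1 - δ) • xstar‖ ^ 2 + (ρ ^ 2 + ρ * m)) ∂P =
        (1 + ρ / m) *
        ∫ ω, ‖iterate X f δ η x0 (fun s i => v s i ω) t - (1 - δ) • xstar‖ ^ 2 ∂P +
          (ρ ^ 2 + ρ * m) := by
      rw [integral_add ((hint ((1 - δ) • xstar)).const_mul _) (integrable_const _),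
        integral_const_mul]
      simp
    refine (le_of_eq e3).trans ?_
    have h4 : (1 + ρ / m) * ∫ ω, ‖iterate X f δ η x0 (fun s i => v s i ω) t -
        (1 - δ) • xstar‖ ^ 2 ∂P ≤ (1 + ρ / m) * m ^ 2 :=
      mul_le_mul_of_nonneg_left hEm (by positivity)
    have h5 : (1 + ρ / m) * m ^ 2 + (ρ ^ 2 + ρ * m) = (m + ρ) ^ 2 := by
      field_simp
      ring
    have h6 : m + ρ = 2 * q := by rw [hm]; linarith
    have h7 : (2 * q) ^ 2 = ε := by rw [mul_pow, hq2]; ring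
    rw [h6, h7] at h5
    linarith
  -- For δ ≥ 1 the iterates have norm at most (δ-1)R, so they are within δR ≤ q of x⋆ at all times.
  · have h := integral_mono (hint xstar) (integrable_const (q ^ 2)) fun ω => by
      refine pow_le_pow_left₀ (norm_nonneg _) (le_trans ?_ hδR) 2
      have h1 := norm_iterate_sub_le (η := η) (f := f) hG h0 (fun s i => v s i ω) t xstar
      rw [abs_of_nonpos (sub_nonpos.2 hδ1)] at h1
      linarith
    refine h.trans ?_
    simp only [integral_const, probReal_univ, smul_eq_mul, one_mul, hq2]
    linarith

end Rate
end BanditGame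
end

theorem mainTheorem2 {n : ℕ} (hn : 0 < n) {d : Fin n → ℕ} (hd : ∀ i, 0 < d i)
    (X : (i : Fin n) → Set (BanditGame.Strat (d i)))
    (f : Fin n → BanditGame.Profile d → ℝ)
    (hf : ∀ i, Measurable (fun x : BanditGame.jointSet X => f i x))
    (α β r R : ℝ) (hG : BanditGame.StandingAssumption X f α β r R)
    {Ω : Type*} [MeasurableSpace Ω] (P : Measure Ω) [IsProbabilityMeasure P]
    -- `v t i` is the direction drawn by player `i` in round `t`; all draws are independent
    (v : ℕ → (i : Fin n) → Ω → BanditGame.USphere (d i))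
    (hv_meas : ∀ t i, Measurable (v t i))
    (hv_law : ∀ t i, P.map (v t i) = BanditGame.uniformSphere (d i))
    (hv_indep : iIndepFun (fun p : ℕ × Fin n => v p.1 p.2) P) :
    (∃! xstar, BanditGame.IsNash X f xstar) ∧
    ∀ xstar, BanditGame.IsNash X f xstar →
    ∀ ε : ℝ, 0 < ε →
      ((∃ L : ℝ, BanditGame.JacobianLipschitz X f L ∧
          -- `ε < C² · min {1 / (L² n³), 4 r² / α²}`, where the first bound is void if `L = 0`
          L ^ 2 * (n : ℝ) ^ 3 * ε < BanditGame.gameConst n α β R ^ 2 ∧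
          ε < BanditGame.gameConst n α β R ^ 2 * (4 * r ^ 2 / α ^ 2)) ∨
        (n = 1 ∧ ε < 4 * r ^ 2 * ((1 + β / α) * R + β / α) ^ 2)) →
    ∀ δ : ℝ, δ = α * √(ε / 4) / BanditGame.gameConst n α β R →
      -- the profiles played by the algorithm are admissible
      (∀ i, ∀ y ∈ (1 - δ) • X i, ∀ u : BanditGame.USphere (d i),
        y + δ • (u : BanditGame.Strat (d i)) ∈ X i) →
    ∀ η : ℕ → ℝ, (∀ t : ℕ, 1 ≤ t → η t = 2 / (α * t)) →
    ∀ x0 : BanditGame.Profile d, (∀ i, x0 i ∈ (1 - δ) • X i) →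
    ∀ t : ℕ,
      max (32 * α ^ 4 * ε * R ^ 2)
          (64 * BanditGame.gameConst n α β R ^ 2 * BanditGame.Fstar X f *
            ((∑ i, d i : ℕ) : ℝ) ^ 2 * n) / (α ^ 4 * ε ^ 2) ≤ (t : ℝ) →
      Integrable (fun ω =>
        ‖BanditGame.iterate X f δ η x0 (fun s i => v s i ω) t - xstar‖ ^ 2) P ∧
      ∫ ω, ‖BanditGame.iterate X f δ η x0 (fun s i => v s i ω) t - xstar‖ ^ 2 ∂P ≤ ε := by
  refine ⟨hG.existsUnique_isNash, ?_⟩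
  -- The argument compares the iterates with `(1 - δ) • xstar`, using the strong monotonicity of the
  -- unsmoothed gradient map, so neither the Jacobian nor the upper bounds on `ε` are needed.
  intro xstar hN ε hε _ δ hδ hA η hη x0 h0 t ht
  exact ⟨BanditGame.integrable_norm_iterate_sub_sq hG hf hA h0 hv_meas t xstar,
    BanditGame.integral_norm_iterate_sub_sq_le hn hG hf hd hA h0 hv_meas hv_law hv_indep hN hη hε
      hδ ht⟩
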